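/- **Setting.** Let $\mathcal G=(\{1,\dots,n\},\mathcal E)$ be a connected undirected graph, $n,p\ge 1$. For $\mathbf x\in\mathbb R^{n\times p}$ with rows $\mathbf x_{(i)}\in\mathbb R^p$ use the Frobenius norm, and put $\bar{\mathbf x}=\frac1n\mathbf 1\mathbf 1^T\mathbf x$. Let $W=[w_{ij}]\in\mathbb R^{n\times n}$ be symmetric with $w_{ij}=0$ if $i\ne j$ and $(i,j)\notin\mathcal E$ and $w_{ij}>0$ otherwise, $\mathrm{null}(I-W)=\mathrm{span}\{\mathbf 1\}$, and $I\succeq W\succ -I$; $\lambda_n(W)$ denotes its smallest eigenvalue, and $\|\mathbf x\|_{I-W}^2=\langle \mathbf x,(I-W)\mathbf x\rangle$. For each $i$ let $f_i:\mathbb R^p\to\mathbb R$ be differentiable with $L_{f_i}$-Lipschitz gradient ($L_{f_i}>0$), and $r_i:\mathbb R^p\to\mathbb R\cup\{+\infty\}$, such that $f_i+r_i$ is proper, lower semicontinuous and coercive. Assume that for each $i$ the gradient $\nabla f_i$ is bounded on $\mathbb R^p$ and that the subgradients $\xi_i\in\partial r_i(u)$, $u\in\mathbb R^p$, are bounded by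 a constant ($\partial$ is the limiting subdifferential). Let $L_f=\max_i L_{f_i}$, $r(\mathbf x)=\sum_i r_i(\mathbf x_{(i)})$, $s(\mathbf x)=\sum_i\big(f_i(\mathbf x_{(i)})+r_i(\mathbf x_{(i)})\big)$, let $\nabla\mathbf f(\mathbf x)\in\mathbb R^{n\times p}$ have rows $\nabla f_i(\mathbf x_{(i)})^T$, and $$\hat{\mathcal L}_{\alpha}(\mathbf x)=\sum_{i=1}^n f_i(\mathbf x_{(i)})+\frac1{2\alpha}\|\mathbf x\|_{I-W}^2+r(\mathbf x).$$ The composite consensus problem is to minimize $s(\mathbf x)$ subject to $\mathbf x_{(i)}=\mathbf x_{(j)}$ for all $(i,j)\in\mathcal E$; a feasible $\mathbf x$ is called stationary for it if $\mathbf 1^T(\nabla\mathbf f(\mathbf x)+\xi)=0$ for some $\xi\in\partial r(\mathbf x)$. Let $0<\epsilon\le1$ and $\alpha_k=\frac{1}{L_f(k+1)^{\epsilon}}$, let $\mathbf x^0$ be arbitrary, and let $\{\mathbf x^k\}$ be any sequence generated by Prox-DGD, i.e. for $k=0,1,\dots$ $$\mathbf x^{k+1}\in\operatorname*{argmin}_{\mathbf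 u}\Big\{\alpha_k r(\mathbf u)+\tfrac12\big\|\mathbf u-\big(W\mathbf x^k-\alpha_k\nabla\mathbf f(\mathbf x^k)\big)\big\|^2\Big\}.$$ Let $\xi^{k+1}$ be defined by $\mathbf x^{k+1}+\alpha_k\xi^{k+1}=W\mathbf x^k-\alpha_k\nabla\mathbf f(\mathbf x^k)$. **Theorem 4.** The following hold. (a) If all $r_i$ are convex, or if $\lambda_n(W)>0$, then $\{\hat{\mathcal L}_{\alpha_k}(\mathbf x^k)\}$ and $\{s(\mathbf x^k)\}$ converge to the same (finite) limit. (b) If all $r_i$ are convex, then $\sum_{k=0}^\infty\big(\alpha_k^{-1}(1+\lambda_n(W))-L_f\big)\|\mathbf x^{k+1}-\mathbf x^k\|^2<\infty$. If $\lambda_n(W)>0$ (and the $r_i$ are not necessarily convex), then $\sum_{k=0}^\infty\big(\alpha_k^{-1}\lambda_n(W)-L_f\big)\|\mathbf x^{k+1}-\mathbf x^k\|^2<\infty$. (c) One has $\xi^{k+1}\in\partial r(\mathbf x^{k+1})$ for all $k\ge0$. If there are a constant $L_r>0$ and an integer $k_0>0$ with $\|\xi^{k+1}-\xi^k\|\le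 L_r\|\mathbf x^{k+1}-\mathbf x^k\|$ for all $k>k_0$, then $\lim_{k\to\infty}\mathbf 1^T(\nabla\mathbf f(\mathbf x^k)+\xi^{k+1})=0$, and any limit point of $\{\mathbf x^k\}$ is a stationary point of the composite consensus problem. (d) If $\{\mathbf x^k\}$ has an isolated accumulation point, then $\{\mathbf x^k\}$ converges to that point. (e) If all $f_i$ and $r_i$ are convex and $\lambda_n(W)>0$, then the composite consensus problem has a finite attained optimal value $s_{\mathrm{opt}}$, and $$\bar s^K=\frac{\sum_{k=0}^K\alpha_k\, s(\bar{\mathbf x}^{k+1})}{\sum_{k=0}^K\alpha_k}$$ is finite for every $K$ and converges to $s_{\mathrm{opt}}$ as $K\to\infty$, with $|\bar s^K-s_{\mathrm{opt}}|$ of the order $\mathcal O(K^{-\epsilon})$ if $0<\epsilon<\frac12$; $\mathcal O(\ln K/\sqrt K)$ if $\epsilon=\frac12$; $\mathcal O(K^{-(1-\epsilon)})$ if $\frac12<\epsilon<1$; $\mathcal O(1/\ln K)$ if $\epsilon=1$. -/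

import Mathlib

open Filter Topology Asymptotics
open scoped BigOperators

noncomputable section

namespace ProxDGD

/-- The space `ℝᵖ` with its Euclidean norm. -/
abbrev Vec (p : ℕ) : Type := EuclideanSpace ℝ (Fin p)

/-- The space `ℝⁿˣᵖ` of stacked local copies (the rows are `x i`), with the Frobenius norm. -/
abbrev Stack (n p : ℕ) : Type := PiLp 2 (fun _ : Fin n => Vec p)

/-! ### Extended-real-valued functions and subdifferentials -/

section Functions

variable {E : Type*} [NormedAddCommGroup E] [InnerProductSpace ℝ E]

/-- `h` takes values in `ℝ ∪ {+∞}` and is not identically `+∞`. -/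
def IsProper (h : E → EReal) : Prop :=
  (∀ x, h x ≠ ⊥) ∧ ∃ x, h x ≠ ⊤

/-- `h u → +∞` as `‖u‖ → +∞`. -/
def IsCoercive (h : E → EReal) : Prop :=
  Tendsto h (comap (fun u : E => ‖u‖) atTop) (𝓝 ⊤)

/-- Convexity of an extended-real-valued function: its epigraph is convex. -/
def IsConvexFun (h : E → EReal) : Prop :=
  Convex ℝ {q : E × ℝ | h q.1 ≤ (q.2 : EReal)}

/-- The Fréchet (regular) subdifferential of `h` at `x`:
`h y ≥ h x + ⟪v, y - x⟫ + o(‖y - x‖)`; it is empty where `h` is not finite. -/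
def frechetSubdiff (h : E → EReal) (x : E) : Set E :=
  {v | h x ≠ ⊤ ∧ h x ≠ ⊥ ∧ ∀ δ : ℝ, 0 < δ → ∀ᶠ y in 𝓝 x,
    h x + ((inner ℝ v (y - x) - δ * ‖y - x‖ : ℝ) : EReal) ≤ h y}

/-- The limiting (Mordukhovich) subdifferential of `h` at `x`; it is empty where `h` is not
finite. For a proper lower semicontinuous convex function it is the usual convex
subdifferential. -/
def subdiff (h : E → EReal) (x : E) : Set E :=
  {v | h x ≠ ⊤ ∧ h x ≠ ⊥ ∧ ∃ (y : ℕ → E) (w : ℕ → E),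
    Tendsto y atTop (𝓝 x) ∧ Tendsto (fun m => h (y m)) atTop (𝓝 (h x)) ∧
    (∀ m, w m ∈ frechetSubdiff h (y m)) ∧ Tendsto w atTop (𝓝 v)}

/-- The (set-valued) proximal operator
`prox_{a h}(y) = argmin_u { a h(u) + ‖u - y‖² / 2 }`. -/
def prox (a : ℝ) (h : E → EReal) (y : E) : Set E :=
  {z | ∀ u, (a : EReal) * h z + ((‖z - y‖ ^ 2 / 2 : ℝ) : EReal) ≤
    (a : EReal) * h u + ((‖u - y‖ ^ 2 / 2 : ℝ) : EReal)}

/-- `h` is differentiable and its gradient is Lipschitz with constant `L > 0`. -/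
def IsLipschitzDifferentiable [CompleteSpace E] (h : E → ℝ) (L : ℝ) : Prop :=
  0 < L ∧ Differentiable ℝ h ∧ ∀ u v, ‖gradient h u - gradient h v‖ ≤ L * ‖u - v‖

end Functions

/-! ### The network -/

/-- The assumptions on the mixing matrix `W` of the network `G`. -/
structure IsMixingMatrix {n : ℕ} (G : SimpleGraph (Fin n)) (W : Matrix (Fin n) (Fin n) ℝ) :
    Prop where
  /-- nonadjacent distinct nodes have weight zero -/
  graph_zero : ∀ i j, i ≠ j → ¬ G.Adj i j → W i j = 0
  /-- all the other weights (the diagonal ones included) are positive -/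
  graph_pos : ∀ i j, i = j ∨ G.Adj i j → 0 < W i j
  symm : W.IsSymm
  null_space : LinearMap.ker (Matrix.toLin' (1 - W)) = Submodule.span ℝ {fun _ => (1 : ℝ)}
  /-- `I ⪰ W` -/
  le_one : (1 - W).PosSemidef
  /-- `W ≻ -I` -/
  neg_one_lt : (W + 1).PosDef

variable {n p : ℕ}

/-- The smallest eigenvalue `λ_n(W)` of a symmetric matrix. -/
def lamMin (W : Matrix (Fin n) (Fin n) ℝ) : ℝ := sInf (spectrum ℝ W)

/-- The matrix product `W x`. -/
def mix (W : Matrix (Fin n) (Fin n) ℝ) (x : Stack n p) : Stack n p :=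
  WithLp.toLp 2 fun i => ∑ j, W i j • x j

/-- `‖x‖²_{I - W} = ⟨x, (I - W) x⟩`. -/
def seminormSq (W : Matrix (Fin n) (Fin n) ℝ) (x : Stack n p) : ℝ :=
  inner ℝ x (x - mix W x)

/-- The stacked average: each row of it is the mean of the rows of `x`. -/
def avg (x : Stack n p) : Stack n p :=
  WithLp.toLp 2 fun _ => (n : ℝ)⁻¹ • ∑ j, x j

/-- The feasible set of the consensus problem: `x_(i) = x_(j)` for each edge `(i, j)`. -/
def consensusSet (G : SimpleGraph (Fin n)) : Set (Stack n p) :=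
  {x | ∀ i j, G.Adj i j → x i = x j}

/-! ### The objective -/

/-- `∑ i, f_i (x_(i))`. -/
def smoothSum (f : Fin n → Vec p → ℝ) (x : Stack n p) : ℝ := ∑ i, f i (x i)

/-- `r(x) = ∑ i, r_i (x_(i))`. -/
def rSum (r : Fin n → Vec p → EReal) (x : Stack n p) : EReal := ∑ i, r i (x i)

/-- The stacked gradient `∇f(x)`, with rows `∇f_i (x_(i))`. -/
def gradStack (f : Fin n → Vec p → ℝ) (x : Stack n p) : Stack n p :=
  WithLp.toLp 2 fun i => gradient (f i) (x i)

/-- The composite objective `s(x) = ∑ i, (f_i (x_(i)) + r_i (x_(i)))`. -/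
def objective (f : Fin n → Vec p → ℝ) (r : Fin n → Vec p → EReal) (x : Stack n p) : EReal :=
  ∑ i, ((f i (x i) : EReal) + r i (x i))

/-- The Lyapunov function `∑ i, f_i (x_(i)) + ‖x‖²_{I - W} / (2 a) + r(x)`. -/
def lyapunov (W : Matrix (Fin n) (Fin n) ℝ) (f : Fin n → Vec p → ℝ) (r : Fin n → Vec p → EReal)
    (a : ℝ) (x : Stack n p) : EReal :=
  ((smoothSum f x + 1 / (2 * a) * seminormSq W x : ℝ) : EReal) + rSum r x

/-- First-order stationary points of `min s(x)` subject to consensus over the edges of `G`: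
`x` is feasible and `1ᵀ(∇f(x) + ξ) = 0` for some `ξ ∈ ∂r(x)`. Over a connected graph this is
`0 ∈ ∇f(x) + ∂r(x) + N(x)`, with `N(x)` the normal cone of the feasible subspace. -/
def IsStationary (G : SimpleGraph (Fin n)) (f : Fin n → Vec p → ℝ) (r : Fin n → Vec p → EReal)
    (x : Stack n p) : Prop :=
  x ∈ consensusSet G ∧ ∃ ξ ∈ subdiff (rSum r) x, ∑ i, (gradStack f x i + ξ i) = 0

/-! ### The algorithm -/

/-- The constant `L_f = max_i L_{f_i}`. -/
def maxConst (L : Fin n → ℝ) : ℝ := ⨆ i, L i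

/-- The step sizes `α_k = 1 / (L_f (k + 1)^ε)`. -/
def stepSize (Lf ε : ℝ) (k : ℕ) : ℝ := 1 / (Lf * ((k : ℝ) + 1) ^ ε)

/-- `x` is a sequence generated by Prox-DGD with step sizes `α` (from an arbitrary `x 0`). -/
def IsProxDGD (W : Matrix (Fin n) (Fin n) ℝ) (f : Fin n → Vec p → ℝ)
    (r : Fin n → Vec p → EReal) (α : ℕ → ℝ) (x : ℕ → Stack n p) : Prop :=
  ∀ k, x (k + 1) ∈ prox (α k) (rSum r) (mix W (x k) - α k • gradStack f (x k))

/-- `ξ (k + 1)` is the prox-subgradient of the `k`-th step of Prox-DGD: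
`x (k + 1) + α_k ξ (k + 1) = W x (k) - α_k ∇f(x (k))`. (The entry `ξ 0` plays no role.) -/
def IsProxSubgradSeq (W : Matrix (Fin n) (Fin n) ℝ) (f : Fin n → Vec p → ℝ)
    (α : ℕ → ℝ) (x ξ : ℕ → Stack n p) : Prop :=
  ∀ k, x (k + 1) + α k • ξ (k + 1) = mix W (x k) - α k • gradStack f (x k)

/-- The ergodic objective `(∑_{k ≤ K} α_k s(x̄^{k+1})) / ∑_{k ≤ K} α_k`. -/
def ergodicObjective (f : Fin n → Vec p → ℝ) (r : Fin n → Vec p → EReal) (α : ℕ → ℝ)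
    (x : ℕ → Stack n p) (K : ℕ) : EReal :=
  (∑ k ∈ Finset.range (K + 1), (α k : EReal) * objective f r (avg (x (k + 1)))) /
    ((∑ k ∈ Finset.range (K + 1), α k : ℝ) : EReal)

end ProxDGD

end

/-! The boundedness hypotheses tame the problem first. A lower semicontinuous `r` whose limiting
subgradients are bounded is finite and Lipschitz (`exists_lipschitz_of_subdiff_bounded`): otherwise
`r u + M * ‖u - x‖` would have a minimizer away from `x`, and hence a subgradient of norm `M`. So
the prox-subgradients are bounded, and Prox-DGD becomes an inexact consensus iteration `x (k + 1) =
T (x k) - α k • v k` with bounded `v`, where `T` is multiplication by `W` and `P` is averaging.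
Since `T` contracts the complement of the range of `P` (`exists_isAveraging`), the disagreement `x k
- P (x k)` and the increments are `O(α k)`; the bound on the increments alone gives (d).

For (a) and (b), each step is a proximal gradient step on the Lyapunov function with `α k` frozen,
so it descends (`lyapunov_descent`). Replacing `α k` by `α (k + 1)` costs only `O(α k - α (k + 1))`,
because the penalty is quadratic in the disagreement; these costs telescope. The penalty is itself
`O(α k)`, so the Lyapunov values and the objective values share their limit.

For (c) neither convexity nor `lamMin W > 0` is available, and the descent may fail in the
disagreement directions. If the subgradients vary slowly, the disagreement of the increments
contracts too, so adding a multiple of its square over `α k` to the Lyapunov function restores the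
descent (`tendsto_proj_zero`). This yields `∑ α k * ‖P (v k)‖ ^ 2 < ∞`, and slow variation together
with `∑ α k = ∞` forces `P (v k) → 0`. Stationarity of the limit points follows by compactness.

For (e), the averages `P (x k)` follow a subgradient method up to `O(α k ^ 2)` errors
(`ergodic_estimate`). Summation bounds the ergodic gap by `(c₁ + c₂ * ∑ α k ^ 2) / ∑ α k`, and the
rates are the asymptotics of power sums. -/

noncomputable section

namespace ProxDGD

/-! ### Real sequences -/

section Sequences

/-- A sequence which is bounded below and decreases up to summable errors converges, and its
decrements are summable. -/
theorem tendsto_and_summable_of_descent {V u e : ℕ → ℝ} {b : ℝ} (hb : ∀ k, b ≤ V k)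
    (hV : ∀ᶠ k in atTop, V (k + 1) ≤ V k - u k + e k) (hu : ∀ᶠ k in atTop, 0 ≤ u k)
    (he : Summable e) : (∃ l, Tendsto V atTop (𝓝 l)) ∧ Summable u := by
  obtain ⟨N, hN⟩ := eventually_atTop.1 (hV.and hu)
  have hs := he.hasSum.tendsto_sum_nat
  -- With the accumulated errors removed the sequence is eventually antitone. It stays bounded below
  -- because the partial sums of `e` are bounded above.
  set A : ℕ → ℝ := fun k => V k - ∑ j ∈ Finset.range k, e j with hA
  have hstep : ∀ k, N ≤ k → A (k + 1) ≤ A k - u k := by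
    intro k hk
    have := (hN k hk).1
    simp only [hA, Finset.sum_range_succ]
    linarith
  obtain ⟨B, hB⟩ := hs.bddAbove_range
  have hlow : ∀ k, b - B ≤ A k := by
    intro k
    have h1 := hb k
    have h2 := hB ⟨k, rfl⟩
    simp only [hA]
    linarith
  have hanti : Antitone fun m => A (m + N) := by
    refine antitone_nat_of_succ_le fun m => ?_
    have h1 := hstep (m + N) (by omega)
    have h2 := (hN (m + N) (by omega)).2
    rw [show m + 1 + N = m + N + 1 by ring]
    linarith
  have hlim := tendsto_atTop_ciInf hanti ⟨b - B, by rintro _ ⟨m, rfl⟩; exact hlow _⟩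
  have hlim' := (tendsto_add_atTop_iff_nat (f := A) N).1 hlim
  constructor
  · refine ⟨_, (hlim'.add hs).congr fun k => ?_⟩
    simp [hA]
  · refine (summable_nat_add_iff N).1 ?_
    refine summable_of_sum_range_le (c := A N - (b - B)) (fun m => (hN _ (by omega)).2) ?_
    intro m
    have : ∀ m, ∑ i ∈ Finset.range m, u (i + N) ≤ A N - A (m + N) := by
      intro m
      induction m with
      | zero => simp
      | succ m ih =>
        rw [Finset.sum_range_succ, show m + 1 + N = m + N + 1 by ring]
        have := hstep (m + N) (by omega)
        linarith
    linarith [this m, hlow (m + N)]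

/-- The properties of the step sizes used in the convergence analysis. -/
structure IsVanishingStep (α : ℕ → ℝ) : Prop where
  pos : ∀ k, 0 < α k
  anti : Antitone α
  tendsto_zero : Tendsto α atTop (𝓝 0)
  tendsto_ratio : Tendsto (fun k => α k / α (k + 1)) atTop (𝓝 1)

variable {α : ℕ → ℝ}

theorem IsVanishingStep.summable_sub (hα : IsVanishingStep α) :
    Summable fun k => α k - α (k + 1) := by
  refine summable_of_sum_range_le (c := α 0) (fun k => sub_nonneg.2 (hα.anti k.le_succ)) ?_
  intro m
  rw [Finset.sum_range_sub']
  linarith [hα.pos m]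

theorem IsVanishingStep.le_two_mul (hα : IsVanishingStep α) :
    ∀ᶠ k in atTop, α k ≤ 2 * α (k + 1) := by
  filter_upwards [hα.tendsto_ratio.eventually (eventually_lt_nhds one_lt_two)] with k hk
  exact ((div_lt_iff₀ (hα.pos _)).1 hk).le

/-- An eventually affinely contracted sequence is bounded. -/
theorem exists_le_of_affine_contraction {q : ℕ → ℝ} {ρ D : ℝ} (hρ : 0 ≤ ρ) (hρ1 : ρ < 1)
    (h : ∀ᶠ k in atTop, q (k + 1) ≤ ρ * q k + D) : ∃ C, 0 ≤ C ∧ ∀ k, q k ≤ C := by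
  obtain ⟨N, hN⟩ := eventually_atTop.1 h
  have h1 : 0 < 1 - ρ := by linarith
  -- `D / (1 - ρ)` is the fixed point of `t ↦ ρ * t + D`, so no value at most `C0` is carried above
  -- `C0`.
  set C0 := max (q N) (D / (1 - ρ)) with hC0
  have hD : D ≤ (1 - ρ) * C0 := by
    rw [mul_comm, ← div_le_iff₀ h1]; exact le_max_right _ _
  have htail : ∀ m, q (m + N) ≤ C0 := by
    intro m
    induction m with
    | zero => simp [hC0]
    | succ m ih =>
      rw [show m + 1 + N = m + N + 1 by ring]
      have := hN (m + N) (by omega)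
      nlinarith
  obtain ⟨C1, hC1⟩ := (Finset.finite_toSet (Finset.range N) |>.image q).bddAbove
  refine ⟨max 0 (max C0 C1), le_max_left _ _, fun k => ?_⟩
  rcases lt_or_ge k N with hk | hk
  · exact (hC1 ⟨k, by simpa using hk, rfl⟩).trans
      ((le_max_right _ _).trans (le_max_right _ _))
  · have := htail (k - N)
    rw [Nat.sub_add_cancel hk] at this
    exact this.trans ((le_max_left _ _).trans (le_max_right _ _))

/-- A contraction perturbed by errors of order `α` yields a sequence of order `α`. -/
theorem IsVanishingStep.exists_le_mul (hα : IsVanishingStep α) {t : ℕ → ℝ} {ρ D : ℝ}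
    (ht : ∀ k, 0 ≤ t k) (hρ : 0 ≤ ρ) (hρ1 : ρ < 1) (hD : 0 ≤ D)
    (h : ∀ k, t (k + 1) ≤ ρ * t k + D * α k) :
    ∃ C, 0 ≤ C ∧ ∀ k, t k ≤ C * α k := by
  have hlim : Tendsto (fun k => α k / α (k + 1) * ρ) atTop (𝓝 ρ) := by
    simpa using hα.tendsto_ratio.mul_const ρ
  have hmid : ρ < (1 + ρ) / 2 := by linarith
  -- Dividing by `α` changes the factor `ρ` into `α k / α (k + 1) * ρ`, which eventually lies below
  -- the midpoint of `ρ` and `1`.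
  have key : ∀ᶠ k in atTop,
      t (k + 1) / α (k + 1) ≤ (1 + ρ) / 2 * (t k / α k) + 2 * D := by
    filter_upwards [hlim.eventually (eventually_lt_nhds hmid), hα.le_two_mul] with k h1 h2
    have p0 := hα.pos k
    have p1 := hα.pos (k + 1)
    have e1 : α k / α (k + 1) ≤ 2 := (div_le_iff₀ p1).2 h2
    calc t (k + 1) / α (k + 1) ≤ (ρ * t k + D * α k) / α (k + 1) := by gcongr; exact h k
      _ = (α k / α (k + 1) * ρ) * (t k / α k) + (α k / α (k + 1)) * D := by
        field_simp
      _ ≤ (1 + ρ) / 2 * (t k / α k) + 2 * D := by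
        have : 0 ≤ t k / α k := div_nonneg (ht k) p0.le
        gcongr
  obtain ⟨C, hC, hq⟩ := exists_le_of_affine_contraction (q := fun k => t k / α k)
    (by linarith) (by linarith) key
  exact ⟨C, hC, fun k => (div_le_iff₀ (hα.pos k)).1 (hq k)⟩

/-- If `∑ α_k ‖v_k‖²` converges while `∑ α_k` diverges, and `v` varies slowly with respect to
`α`, then `v` tends to zero. -/
theorem IsVanishingStep.tendsto_zero_of_summable {E : Type*} [NormedAddCommGroup E]
    (hα : IsVanishingStep α) (hdiv : ¬ Summable α) {v : ℕ → E}
    (hs : Summable fun k => α k * ‖v k‖ ^ 2) {C : ℝ} (hC : 0 ≤ C)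
    (hv : ∀ᶠ k in atTop, ‖v (k + 1) - v k‖ ≤ C * α k) : Tendsto v atTop (𝓝 0) := by
  have hs1 : Summable fun k => α (k + 1) * ‖v (k + 1)‖ ^ 2 := (summable_nat_add_iff 1).2 hs
  -- The cube is the right power: its increment is a difference of size `O(α k)` times a quadratic
  -- factor, which is exactly what the summable series controls.
  have hsum : Summable fun k => dist (‖v k‖ ^ 3) (‖v (k + 1)‖ ^ 3) := by
    refine Summable.of_norm_bounded_eventually_nat
      (((hs.add (hs1.mul_left 2)).mul_left (2 * C))) ?_
    filter_upwards [hv, hα.le_two_mul] with k h1 h2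
    have h3 : |‖v (k + 1)‖ - ‖v k‖| ≤ C * α k := (abs_norm_sub_norm_le _ _).trans h1
    set a := ‖v k‖
    set b := ‖v (k + 1)‖
    have ha : 0 ≤ a := norm_nonneg _
    have hb : 0 ≤ b := norm_nonneg _
    have p0 := hα.pos k
    rw [Real.norm_eq_abs, abs_of_nonneg dist_nonneg, dist_comm, Real.dist_eq,
      show b ^ 3 - a ^ 3 = (b - a) * (b ^ 2 + b * a + a ^ 2) by ring, abs_mul,
      abs_of_nonneg (show 0 ≤ b ^ 2 + b * a + a ^ 2 by positivity)]
    calc |b - a| * (b ^ 2 + b * a + a ^ 2) ≤ C * α k * (2 * (a ^ 2 + b ^ 2)) := by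
          gcongr
          nlinarith [sq_nonneg (a - b), sq_nonneg a, sq_nonneg b]
      _ = 2 * C * (α k * a ^ 2 + α k * b ^ 2) := by ring
      _ ≤ 2 * C * (α k * a ^ 2 + (2 * α (k + 1)) * b ^ 2) := by gcongr
      _ = _ := by ring
  obtain ⟨l, hl⟩ := cauchySeq_tendsto_of_complete (cauchySeq_of_summable_dist hsum)
  have hl0 : 0 ≤ l := ge_of_tendsto' hl fun k => by positivity
  have hzero : l = 0 := by
    by_contra hne
    have hlpos : 0 < l := lt_of_le_of_ne hl0 (Ne.symm hne)
    -- If `‖v k‖ ^ 2 < c ≤ 1`, then `‖v k‖ ^ 3 ≤ ‖v k‖ ^ 2 < l / 2`, which is eventually false. So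
    -- the squares stay above `c` and `∑ α k` would converge.
    set c := min 1 (l / 2)
    have hc : 0 < c := lt_min one_pos (by linarith)
    have hc1 : c ≤ 1 := min_le_left _ _
    apply hdiv
    refine Summable.of_norm_bounded_eventually_nat (hs.mul_left (1 / c)) ?_
    filter_upwards [hl.eventually (eventually_gt_nhds (show l / 2 < l by linarith))] with k hk
    have p0 := hα.pos k
    have ha : 0 ≤ ‖v k‖ := norm_nonneg _
    have : c ≤ ‖v k‖ ^ 2 := by
      by_contra hcon
      push Not at hcon
      have h1 : ‖v k‖ ≤ 1 := by nlinarith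
      have h2 : ‖v k‖ ^ 3 ≤ ‖v k‖ ^ 2 := by nlinarith [sq_nonneg ‖v k‖]
      have h3 : c ≤ l / 2 := min_le_right _ _
      linarith
    rw [Real.norm_eq_abs, abs_of_pos p0, ← mul_assoc, mul_comm (1 / c), mul_assoc]
    refine le_mul_of_one_le_right p0.le ?_
    rw [one_div, inv_mul_eq_div, one_le_div hc]
    exact this
  rw [hzero] at hl
  rw [tendsto_zero_iff_norm_tendsto_zero, Metric.tendsto_atTop]
  intro η hη
  obtain ⟨N, hN⟩ := Metric.tendsto_atTop.1 hl (η ^ 3) (by positivity)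
  refine ⟨N, fun k hk => ?_⟩
  have := hN k hk
  simp only [dist_zero_right, Real.norm_eq_abs, abs_pow, abs_norm] at this ⊢
  exact lt_of_pow_lt_pow_left₀ 3 hη.le this

/-- If the steps of a sequence vanish, then it converges to each isolated accumulation point. -/
theorem tendsto_of_isolated_mapClusterPt {E : Type*} [NormedAddCommGroup E] [ProperSpace E]
    {x : ℕ → E} (hstep : Tendsto (fun k => x (k + 1) - x k) atTop (𝓝 0)) {y : E}
    (hy : MapClusterPt y atTop x) (hiso : ∃ U ∈ 𝓝 y, ∀ z ∈ U, MapClusterPt z atTop x → z = y) :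
    Tendsto x atTop (𝓝 y) := by
  obtain ⟨U, hU, hUy⟩ := hiso
  obtain ⟨η, hη, hball⟩ := Metric.mem_nhds_iff.1 hU
  rw [Metric.tendsto_atTop]
  intro η' hη'
  set r := min (η / 2) η' with hr
  have hr0 : 0 < r := lt_min (by linarith) hη'
  have hrη : r < η := (min_le_left _ _).trans_lt (by linarith)
  -- This annulus contains no accumulation point, so the sequence eventually avoids it. Steps
  -- shorter than its width `r / 2` cannot jump across, so the sequence is trapped in the inner
  -- ball.
  have hcompact : IsCompact (Metric.closedBall y r \ Metric.ball y (r / 2)) :=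
    (isCompact_closedBall y r).diff Metric.isOpen_ball
  have hout : ∀ᶠ k in atTop, x k ∉ Metric.closedBall y r \ Metric.ball y (r / 2) := by
    by_contra hcon
    obtain ⟨z, hz, hzc⟩ := hcompact.exists_mapClusterPt_of_frequently
      (f := x) (l := atTop) (not_eventually.1 hcon |>.mono fun k hk => not_not.1 hk)
    have := hUy z (hball (Metric.closedBall_subset_ball hrη hz.1)) hzc
    exact hz.2 (by rw [this]; exact Metric.mem_ball_self (by linarith))
  have hsmall : ∀ᶠ k in atTop, ‖x (k + 1) - x k‖ < r / 2 := by
    have := (tendsto_zero_iff_norm_tendsto_zero.1 hstep)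
    exact this.eventually (eventually_lt_nhds (by linarith))
  obtain ⟨N, hN⟩ := eventually_atTop.1 (hout.and hsmall)
  obtain ⟨m, hm, hxm⟩ := frequently_atTop.1
    (mapClusterPt_iff_frequently.1 hy _ (Metric.ball_mem_nhds y (show 0 < r / 2 by linarith))) N
  have : ∀ j, x (m + j) ∈ Metric.ball y (r / 2) := by
    intro j
    induction j with
    | zero => simpa using hxm
    | succ j ih =>
      have h1 := (hN (m + j) (by omega)).2
      have h2 := (hN (m + (j + 1)) (by omega)).1
      rw [← dist_eq_norm] at h1
      rw [Metric.mem_ball] at ih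
      by_contra hcon
      refine h2 ⟨?_, hcon⟩
      rw [Metric.mem_closedBall]
      have := dist_triangle (x (m + j + 1)) (x (m + j)) y
      rw [← add_assoc]
      linarith
  refine ⟨m, fun k hk => ?_⟩
  have h1 := Metric.mem_ball.1 (this (k - m))
  rw [Nat.add_sub_cancel' hk] at h1
  have : r ≤ η' := min_le_right _ _
  linarith

end Sequences

/-! ### Smooth functions, proximal subgradients and convexity -/

section FunctionFacts

variable {E : Type*} [NormedAddCommGroup E] [InnerProductSpace ℝ E]

/-- The quadratic upper bound for a function with Lipschitz gradient. -/
theorem le_quadratic_of_lipschitz_gradient [CompleteSpace E] {f : E → ℝ} {g : E → E} {L : ℝ}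
    (hf : ∀ x, HasGradientAt f (g x) x) (hg : ∀ u v, ‖g u - g v‖ ≤ L * ‖u - v‖) (x y : E) :
    f y ≤ f x + inner ℝ (g x) (y - x) + L / 2 * ‖y - x‖ ^ 2 := by
  set d := y - x with hd
  set φ : ℝ → ℝ := fun t => f (x + t • d) - t * inner ℝ (g x) d - L / 2 * t ^ 2 * ‖d‖ ^ 2
  have hder : ∀ t, HasDerivAt φ (inner ℝ (g (x + t • d)) d - inner ℝ (g x) d
      - L * t * ‖d‖ ^ 2) t := by
    intro t
    have h1 : HasDerivAt (fun t : ℝ => x + t • d) d t := by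
      simpa using ((hasDerivAt_id t).smul_const d).const_add x
    have h2 : HasDerivAt (fun t : ℝ => f (x + t • d)) (inner ℝ (g (x + t • d)) d) t := by
      exact (hf (x + t • d)).hasFDerivAt.comp_hasDerivAt t h1
    have h3 : HasDerivAt (fun t : ℝ => t * inner ℝ (g x) d) (inner ℝ (g x) d) t := by
      simpa using (hasDerivAt_id t).mul_const (inner ℝ (g x) d)
    have h4 : HasDerivAt (fun t : ℝ => L / 2 * t ^ 2 * ‖d‖ ^ 2) (L * t * ‖d‖ ^ 2) t := by
      refine ((((hasDerivAt_id t).pow 2).const_mul (L / 2)).mul_const (‖d‖ ^ 2)).congr_deriv ?_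
      simp only [id, Nat.cast_ofNat, Nat.add_one_sub_one, pow_one]
      ring
    exact (h2.sub h3).sub h4
  have hanti : AntitoneOn φ (Set.Icc 0 1) := by
    refine antitoneOn_of_deriv_nonpos (convex_Icc 0 1)
      (fun t _ => (hder t).continuousAt.continuousWithinAt)
      (fun t _ => (hder t).differentiableAt.differentiableWithinAt) ?_
    intro t ht
    rw [interior_Icc] at ht
    rw [(hder t).deriv, ← inner_sub_left]
    have h1 : ‖g (x + t • d) - g x‖ ≤ L * (t * ‖d‖) := by
      have := hg (x + t • d) x
      rwa [add_sub_cancel_left, norm_smul, Real.norm_eq_abs, abs_of_pos ht.1] at this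
    have h2 := real_inner_le_norm (g (x + t • d) - g x) d
    nlinarith [norm_nonneg d]
  have := hanti (Set.left_mem_Icc.2 zero_le_one) (Set.right_mem_Icc.2 zero_le_one) zero_le_one
  simp only [φ, one_smul, zero_smul, add_zero] at this
  rw [show x + d = y by simp [hd]] at this
  linarith

/-- The quadratic lower bound for a function with Lipschitz gradient. -/
theorem quadratic_le_of_lipschitz_gradient [CompleteSpace E] {f : E → ℝ} {g : E → E} {L : ℝ}
    (hf : ∀ x, HasGradientAt f (g x) x) (hg : ∀ u v, ‖g u - g v‖ ≤ L * ‖u - v‖) (x y : E) :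
    f x + inner ℝ (g x) (y - x) - L / 2 * ‖y - x‖ ^ 2 ≤ f y := by
  have h := le_quadratic_of_lipschitz_gradient (f := fun x => - f x) (g := fun x => - g x) (L := L)
    (fun x => by
      rw [hasGradientAt_iff_hasFDerivAt, map_neg]
      exact (hf x).hasFDerivAt.neg)
    (fun u v => by rw [neg_sub_neg, norm_sub_rev]; exact hg u v) x y
  simp only [inner_neg_left] at h
  linarith

/-- For a convex function, a proximal subgradient is a subgradient. -/
theorem subgradient_of_convexOn {h : E → ℝ} (hc : ConvexOn ℝ Set.univ h) {z w : E} {c : ℝ}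
    (hw : ∀ u, h z + inner ℝ w (u - z) - c * ‖u - z‖ ^ 2 ≤ h u) (u : E) :
    h z + inner ℝ w (u - z) ≤ h u := by
  -- On the segment from `z` to `u` the error is quadratic in `t` while the other terms are linear.
  -- Division by `t` leaves an error that vanishes with `t`.
  have key : ∀ t : ℝ, t ∈ Set.Ioo (0 : ℝ) 1 →
      h z + inner ℝ w (u - z) - t * (c * ‖u - z‖ ^ 2) ≤ h u := by
    intro t ht
    have h1 := hw (z + t • (u - z))
    have h2 := hc.2 (Set.mem_univ z) (Set.mem_univ u) (sub_nonneg.2 ht.2.le) ht.1.le (by ring)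
    rw [show (1 - t) • z + t • u = z + t • (u - z) by module] at h2
    simp only [add_sub_cancel_left, norm_smul, inner_smul_right, Real.norm_eq_abs,
      abs_of_pos ht.1, smul_eq_mul] at h1 h2
    have h3 : t * (h z + inner ℝ w (u - z) - t * (c * ‖u - z‖ ^ 2)) ≤ t * h u := by
      nlinarith
    exact le_of_mul_le_mul_left h3 ht.1
  have hlim : Tendsto (fun t : ℝ => h z + inner ℝ w (u - z) - t * (c * ‖u - z‖ ^ 2))
      (𝓝[>] 0) (𝓝 (h z + inner ℝ w (u - z))) := by
    have : Continuous fun t : ℝ => h z + inner ℝ w (u - z) - t * (c * ‖u - z‖ ^ 2) := by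
      fun_prop
    have := (this.tendsto 0).mono_left (nhdsWithin_le_nhds (s := Set.Ioi 0))
    simpa using this
  refine le_of_tendsto hlim ?_
  filter_upwards [Ioo_mem_nhdsGT (zero_lt_one' ℝ)] with t ht using key t ht

/-- A proximal subgradient of a Lipschitz function is bounded by the Lipschitz constant. -/
theorem norm_le_of_proximal_subgradient {h : E → ℝ} {M : ℝ} (hM : 0 ≤ M)
    (hh : ∀ u v, |h u - h v| ≤ M * ‖u - v‖) {z w : E} {c : ℝ}
    (hw : ∀ u, h z + inner ℝ w (u - z) - c * ‖u - z‖ ^ 2 ≤ h u) : ‖w‖ ≤ M := by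
  have key : ∀ t : ℝ, 0 < t → ‖w‖ ^ 2 - t * (c * ‖w‖ ^ 2) ≤ M * ‖w‖ := by
    intro t ht
    have h1 := hw (z + t • w)
    have h2 := (abs_le.1 (hh (z + t • w) z)).2
    simp only [add_sub_cancel_left, norm_smul, inner_smul_right, Real.norm_eq_abs,
      abs_of_pos ht, real_inner_self_eq_norm_sq] at h1 h2
    have h3 : t * (‖w‖ ^ 2 - t * (c * ‖w‖ ^ 2)) ≤ t * (M * ‖w‖) := by nlinarith
    exact le_of_mul_le_mul_left h3 ht
  have hlim : Tendsto (fun t : ℝ => ‖w‖ ^ 2 - t * (c * ‖w‖ ^ 2)) (𝓝[>] 0) (𝓝 (‖w‖ ^ 2)) := by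
    have : Continuous fun t : ℝ => ‖w‖ ^ 2 - t * (c * ‖w‖ ^ 2) := by fun_prop
    have := (this.tendsto 0).mono_left (nhdsWithin_le_nhds (s := Set.Ioi 0))
    simpa using this
  have h1 : ‖w‖ ^ 2 ≤ M * ‖w‖ := by
    refine le_of_tendsto hlim ?_
    filter_upwards [self_mem_nhdsWithin] with t ht using key t ht
  rcases (norm_nonneg w).eq_or_lt with h0 | h0
  · rw [← h0]; exact hM
  · nlinarith

/-- Near `x` a quadratic error is at most `δ * ‖u - x‖`. This links minimality, in a prox step or in
a penalized problem, to the subdifferential. -/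
theorem mem_frechetSubdiff_of_proximal {h : E → EReal} {x w : E} {c : ℝ} (hT : h x ≠ ⊤)
    (hB : h x ≠ ⊥)
    (hw : ∀ u, h x + ((inner ℝ w (u - x) - c * ‖u - x‖ ^ 2 : ℝ) : EReal) ≤ h u) :
    w ∈ frechetSubdiff h x := by
  refine ⟨hT, hB, fun δ hδ => ?_⟩
  have hlim : Tendsto (fun u => c * ‖u - x‖) (𝓝 x) (𝓝 0) := by
    have : Continuous fun u => c * ‖u - x‖ := by fun_prop
    simpa using this.tendsto x
  filter_upwards [hlim.eventually (eventually_lt_nhds hδ)] with u hu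
  refine le_trans ?_ (hw u)
  refine add_le_add le_rfl (EReal.coe_le_coe_iff.2 ?_)
  nlinarith [norm_nonneg (u - x)]

theorem frechetSubdiff_subset_subdiff (h : E → EReal) (x : E) :
    frechetSubdiff h x ⊆ subdiff h x := fun w hw =>
  ⟨hw.1, hw.2.1, fun _ => x, fun _ => w, tendsto_const_nhds, tendsto_const_nhds, fun _ => hw,
    tendsto_const_nhds⟩

/-- First-order expansion of the norm, with a quadratic remainder. -/
theorem norm_add_le_of_ne_zero {a : E} (ha : a ≠ 0) (v : E) :
    ‖a + v‖ ≤ ‖a‖ + inner ℝ a v / ‖a‖ + ‖v‖ ^ 2 / (2 * ‖a‖) := by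
  have h0 : 0 < ‖a‖ := norm_pos_iff.2 ha
  have h1 := norm_add_sq_real a v
  have h2 : ‖a‖ + inner ℝ a v / ‖a‖ + ‖v‖ ^ 2 / (2 * ‖a‖)
      = (‖a‖ ^ 2 + ‖a + v‖ ^ 2) / (2 * ‖a‖) := by
    rw [h1]; field_simp; ring
  rw [h2, le_div_iff₀ (by positivity)]
  nlinarith [sq_nonneg (‖a‖ - ‖a + v‖)]

/-- A function with bounded gradient is Lipschitz. -/
theorem abs_sub_le_of_gradient_le [CompleteSpace E] {f : E → ℝ} (hf : Differentiable ℝ f) {B : ℝ}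
    (hB : ∀ u, ‖gradient f u‖ ≤ B) (u v : E) : |f u - f v| ≤ B * ‖u - v‖ := by
  have := convex_univ.norm_image_sub_le_of_norm_fderiv_le (𝕜 := ℝ) (f := f) (C := B)
    (fun x _ => hf x) (fun x _ => by
      have h1 := hB x
      rwa [gradient, LinearIsometryEquiv.norm_map] at h1) (Set.mem_univ v) (Set.mem_univ u)
  simpa using this

/-- If `f + r` is proper, lower semicontinuous and coercive, the gradient of `f` is bounded and
the limiting subgradients of `r` are bounded, then `r` is finite and Lipschitz. -/
theorem exists_lipschitz_of_subdiff_bounded [FiniteDimensional ℝ E] [CompleteSpace E]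
    {f : E → ℝ} {r : E → EReal}
    (hf : Differentiable ℝ f) (hproper : IsProper fun u => (f u : EReal) + r u)
    (hlsc : LowerSemicontinuous fun u => (f u : EReal) + r u)
    (hcoer : IsCoercive fun u => (f u : EReal) + r u)
    {B B' : ℝ} (hB : ∀ u, ‖gradient f u‖ ≤ B) (hB' : ∀ u, ∀ v ∈ subdiff r u, ‖v‖ ≤ B') :
    ∃ (ρ : E → ℝ) (M : ℝ), 0 ≤ M ∧ (∀ u, r u = (ρ u : EReal)) ∧
      ∀ u v, |ρ u - ρ v| ≤ M * ‖u - v‖ := by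
  have : ProperSpace E := FiniteDimensional.proper ℝ E
  have hbot : ∀ u, r u ≠ ⊥ := by
    intro u hu
    apply hproper.1 u
    simp [hu]
  obtain ⟨y, hy⟩ := hproper.2
  have hry : r y ≠ ⊤ := by
    intro h
    apply hy
    simp [h]
  have hflip := abs_sub_le_of_gradient_le hf hB
  have hB0 : 0 ≤ B := (norm_nonneg _).trans (hB 0)
  -- `M > B'` excludes subgradients of norm `M`; `M ≥ B + 1` makes `M * ‖u - x‖ - f u` grow at least
  -- linearly.
  set M := max B' B + 1 with hM
  have hMB : B + 1 ≤ M := by simp [hM]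
  have hMB' : B' < M := lt_of_le_of_lt (le_max_left _ _) (lt_add_one _)
  have hM0 : 0 ≤ M := by linarith
  have key : ∀ x, r x ≠ ⊤ ∧ ∀ u, r x ≤ r u + ((M * ‖u - x‖ : ℝ) : EReal) := by
    intro x
    -- This is `r u + M * ‖u - x‖`, split so that lower semicontinuity and coercivity of `f + r`
    -- apply. The aim is that its minimizer is `x` itself.
    set ψ : E → EReal := fun u =>
      ((f u : EReal) + r u) + ((M * ‖u - x‖ - f u : ℝ) : EReal) with hψ
    have hψeq : ∀ u, ψ u = r u + ((M * ‖u - x‖ : ℝ) : EReal) := by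
      intro u
      simp only [hψ]
      induction h : r u with
      | bot => exact absurd h (hbot u)
      | top => rfl
      | coe a =>
        norm_cast
        ring
    have hψlsc : LowerSemicontinuous ψ := by
      refine hlsc.add' ?_ ?_
      · refine Continuous.lowerSemicontinuous ?_
        have := hf.continuous
        exact continuous_coe_real_ereal.comp (by fun_prop)
      · intro u
        exact EReal.continuousAt_add (Or.inr (EReal.coe_ne_bot _)) (Or.inr (EReal.coe_ne_top _))
    have hψy : ψ y ≠ ⊤ := by
      rw [hψeq]
      exact EReal.add_ne_top hry (EReal.coe_ne_top _)
    obtain ⟨c, hc⟩ : ∃ c : ℝ, ψ y ≤ c := by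
      refine ⟨(ψ y).toReal, EReal.le_coe_toReal hψy⟩
    have hfar : ∃ R, ∀ u, R < ‖u‖ → ψ y < ψ u := by
      have h1 := (EReal.tendsto_nhds_top_iff_real.1 hcoer) 0
      rw [eventually_comap] at h1
      obtain ⟨R1, hR1⟩ := eventually_atTop.1 h1
      refine ⟨max R1 (c + M * ‖x‖ + f 0), fun u hu => lt_of_le_of_lt hc ?_⟩
      have h2 : (0 : EReal) < (f u : EReal) + r u :=
        hR1 ‖u‖ ((le_max_left _ _).trans hu.le) u rfl
      have h3 := (le_max_right _ _).trans_lt hu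
      have h4 := (abs_le.1 (hflip u 0)).2
      rw [sub_zero] at h4
      have h5 : ‖u‖ - ‖x‖ ≤ ‖u - x‖ := norm_sub_norm_le u x
      have h6 : c < M * ‖u - x‖ - f u := by nlinarith [norm_nonneg u]
      calc (c : EReal) < ((M * ‖u - x‖ - f u : ℝ) : EReal) := by exact_mod_cast h6
        _ = 0 + ((M * ‖u - x‖ - f u : ℝ) : EReal) := (zero_add _).symm
        _ ≤ ψ u := by
          simp only [hψ]
          gcongr
    obtain ⟨R, hR⟩ := hfar
    obtain ⟨z, -, hz⟩ := LowerSemicontinuousOn.exists_isMinOn (s := Metric.closedBall 0 (max R ‖y‖))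
      ⟨y, by simp⟩ (isCompact_closedBall _ _) (hψlsc.lowerSemicontinuousOn _)
    have hmin : ∀ u, ψ z ≤ ψ u := by
      intro u
      by_cases hu : u ∈ Metric.closedBall (0 : E) (max R ‖y‖)
      · exact hz hu
      · have h1 : ψ z ≤ ψ y := hz (by simp)
        refine h1.trans (hR u ?_).le
        simp only [Metric.mem_closedBall, dist_zero_right, not_le] at hu
        exact (le_max_left _ _).trans_lt hu
    have hrz : r z ≠ ⊤ := by
      intro h
      have h1 := hmin y
      rw [hψeq z, h, EReal.top_add_coe, top_le_iff] at h1
      exact hψy h1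
    have hzx : z = x := by
      by_contra hne
      have ha : z - x ≠ 0 := sub_ne_zero.2 hne
      have h0 : 0 < ‖z - x‖ := norm_pos_iff.2 ha
      -- Away from `x` the distance to `x` has a first-order expansion with quadratic remainder.
      -- Minimality at `z` therefore produces a subgradient of `r` of norm exactly `M`.
      have hmem : -(M / ‖z - x‖) • (z - x) ∈ frechetSubdiff r z := by
        refine mem_frechetSubdiff_of_proximal (c := M / (2 * ‖z - x‖)) hrz (hbot z) fun u => ?_
        have h1 := hmin u
        rw [hψeq, hψeq] at h1
        have h2 := norm_add_le_of_ne_zero ha (u - z)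
        rw [show z - x + (u - z) = u - x by abel] at h2
        induction h : r u with
        | bot => exact absurd h (hbot u)
        | top => exact le_top
        | coe b =>
          induction h' : r z with
          | bot => exact absurd h' (hbot z)
          | top => exact absurd h' hrz
          | coe a =>
            rw [h, h'] at h1
            norm_cast at h1 ⊢
            have h3 := mul_le_mul_of_nonneg_left h2 hM0
            rw [inner_smul_left]
            simp only [conj_trivial]
            have e1 : M * (‖z - x‖ + inner ℝ (z - x) (u - z) / ‖z - x‖
                + ‖u - z‖ ^ 2 / (2 * ‖z - x‖)) = M * ‖z - x‖ +
                M / ‖z - x‖ * inner ℝ (z - x) (u - z) + M / (2 * ‖z - x‖) * ‖u - z‖ ^ 2 := by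
              field_simp
            rw [e1] at h3
            linarith
      have h1 := hB' z _ (frechetSubdiff_subset_subdiff _ _ hmem)
      rw [norm_smul, norm_neg, Real.norm_eq_abs, abs_of_nonneg (by positivity),
        div_mul_cancel₀ _ h0.ne'] at h1
      linarith
    subst hzx
    refine ⟨hrz, fun u => ?_⟩
    have h1 := hmin u
    rw [hψeq, hψeq] at h1
    simpa using h1
  refine ⟨fun u => (r u).toReal, M, hM0,
    fun u => (EReal.coe_toReal (key u).1 (hbot u)).symm, ?_⟩
  have hle : ∀ u v, (r u).toReal - (r v).toReal ≤ M * ‖u - v‖ := by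
    intro u v
    have h1 := (key u).2 v
    rw [← EReal.coe_toReal (key u).1 (hbot u), ← EReal.coe_toReal (key v).1 (hbot v)] at h1
    norm_cast at h1
    rw [norm_sub_rev]
    linarith
  intro u v
  rw [abs_le]
  have h1 := hle u v
  have h2 := hle v u
  rw [norm_sub_rev] at h2
  constructor <;> linarith

theorem convexOn_of_isConvexFun {h : E → ℝ} (hc : IsConvexFun fun u => (h u : EReal)) :
    ConvexOn ℝ Set.univ h := by
  refine ⟨convex_univ, fun u _ v _ a b ha hb hab => ?_⟩
  have h1 : ((u, h u) : E × ℝ) ∈ {q : E × ℝ | (h q.1 : EReal) ≤ (q.2 : EReal)} := le_refl (h u : EReal)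
  have h2 : ((v, h v) : E × ℝ) ∈ {q : E × ℝ | (h q.1 : EReal) ≤ (q.2 : EReal)} := le_refl (h v : EReal)
  have := hc h1 h2 ha hb hab
  simpa using this

/-- The optimality condition of the proximal step. -/
theorem proximal_subgradient_of_mem_prox {h : E → ℝ} {a : ℝ} (ha : 0 < a) {y z w : E}
    (hz : z ∈ prox a (fun u => (h u : EReal)) y) (hw : z + a • w = y) (u : E) :
    h z + inner ℝ w (u - z) - 1 / (2 * a) * ‖u - z‖ ^ 2 ≤ h u := by
  have h1 := hz u
  beta_reduce at h1
  norm_cast at h1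
  subst hw
  rw [show z - (z + a • w) = -(a • w) by abel,
    show u - (z + a • w) = (u - z) - a • w by abel, norm_neg,
    norm_sub_sq_real (u - z), inner_smul_right, real_inner_comm] at h1
  have h2 : a * (h z + inner ℝ w (u - z) - 1 / (2 * a) * ‖u - z‖ ^ 2) ≤ a * h u := by
    have : a * (1 / (2 * a) * ‖u - z‖ ^ 2) = ‖u - z‖ ^ 2 / 2 := by field_simp
    nlinarith
  exact le_of_mul_le_mul_left h2 ha

end FunctionFacts

/-! ### Averaging operators and inexact consensus iterations -/

section Dynamics

variable {E : Type*} [NormedAddCommGroup E] [InnerProductSpace ℝ E]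

/-- `T` is symmetric, fixes the range of the orthogonal projection `P`, and contracts its
orthogonal complement with factor `ρ < 1`. -/
structure IsAveraging (T P : E →ₗ[ℝ] E) (ρ : ℝ) : Prop where
  symm : ∀ x y, inner ℝ (T x) y = inner ℝ x (T y)
  proj_symm : ∀ x y, inner ℝ (P x) y = inner ℝ x (P y)
  proj_idem : ∀ x, P (P x) = P x
  apply_proj : ∀ x, T (P x) = P x
  proj_apply : ∀ x, P (T x) = P x
  nonneg : 0 ≤ ρ
  lt_one : ρ < 1
  contract : ∀ x, ‖T x - P x‖ ≤ ρ * ‖x - P x‖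

namespace IsAveraging

variable {T P : E →ₗ[ℝ] E} {ρ : ℝ}

theorem inner_proj_sub (hT : IsAveraging T P ρ) (x y : E) : inner ℝ (P x) (y - P y) = 0 := by
  rw [inner_sub_right, ← hT.proj_symm, hT.proj_idem, sub_self]

theorem norm_sq_eq (hT : IsAveraging T P ρ) (x : E) :
    ‖x‖ ^ 2 = ‖P x‖ ^ 2 + ‖x - P x‖ ^ 2 := by
  have := norm_add_sq_real (P x) (x - P x)
  rw [hT.inner_proj_sub, add_sub_cancel] at this
  linarith

theorem norm_proj_le (hT : IsAveraging T P ρ) (x : E) : ‖P x‖ ≤ ‖x‖ := by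
  have := hT.norm_sq_eq x
  exact le_of_sq_le_sq (by nlinarith [sq_nonneg ‖x - P x‖]) (norm_nonneg _)

theorem norm_sub_proj_le (hT : IsAveraging T P ρ) (x : E) : ‖x - P x‖ ≤ ‖x‖ := by
  have := hT.norm_sq_eq x
  exact le_of_sq_le_sq (by nlinarith [sq_nonneg ‖P x‖]) (norm_nonneg _)

theorem continuous_proj (hT : IsAveraging T P ρ) : Continuous P :=
  AddMonoidHomClass.continuous_of_bound P 1 fun x => by simpa using hT.norm_proj_le x

theorem norm_apply_le (hT : IsAveraging T P ρ) (x : E) : ‖T x‖ ≤ 2 * ‖x‖ := by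
  have h1 : ‖T x‖ ≤ ‖P x‖ + ‖T x - P x‖ := by
    simpa using norm_add_le (P x) (T x - P x)
  have h2 := hT.contract x
  have h3 := hT.norm_proj_le x
  have h4 := hT.norm_sub_proj_le x
  nlinarith [hT.lt_one, norm_nonneg (x - P x)]

/-- By symmetry `x - T x` is orthogonal to the fixed vector `P x`, so only the disagreement enters
the form. The contraction then places it between `0` and `2 * ‖x - P x‖ ^ 2`. -/
theorem inner_sub_apply (hT : IsAveraging T P ρ) (x : E) :
    inner ℝ x (x - T x) = ‖x - P x‖ ^ 2 - inner ℝ (x - P x) (T x - P x) := by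
  have h1 : inner ℝ (P x) (x - T x) = 0 := by
    rw [inner_sub_right, ← hT.symm, hT.apply_proj, sub_self]
  have h2 : inner ℝ x (x - T x) = inner ℝ (x - P x) (x - T x) := by
    rw [inner_sub_left (𝕜 := ℝ), h1, sub_zero]
  rw [h2, show x - T x = (x - P x) - (T x - P x) by abel, inner_sub_right,
    real_inner_self_eq_norm_sq]

theorem inner_sub_apply_nonneg (hT : IsAveraging T P ρ) (x : E) : 0 ≤ inner ℝ x (x - T x) := by
  rw [hT.inner_sub_apply]
  have h1 := real_inner_le_norm (x - P x) (T x - P x)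
  have h2 := hT.contract x
  nlinarith [hT.lt_one, norm_nonneg (x - P x), sq_nonneg ‖x - P x‖]

theorem inner_sub_apply_le (hT : IsAveraging T P ρ) (x : E) :
    inner ℝ x (x - T x) ≤ 2 * ‖x - P x‖ ^ 2 := by
  rw [hT.inner_sub_apply]
  have h1 := neg_le_of_abs_le (abs_real_inner_le_norm (x - P x) (T x - P x))
  have h2 := hT.contract x
  nlinarith [hT.lt_one, norm_nonneg (x - P x), sq_nonneg ‖x - P x‖]

variable {α : ℕ → ℝ} {x v : ℕ → E} {D : ℝ}

/-- The disagreement of an inexact consensus iteration is of the order of the step size. -/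
theorem exists_disagreement_le (hT : IsAveraging T P ρ) (hα : IsVanishingStep α)
    (hx : ∀ k, x (k + 1) = T (x k) - α k • v k) (hv : ∀ k, ‖v k‖ ≤ D) :
    ∃ C, 0 ≤ C ∧ ∀ k, ‖x k - P (x k)‖ ≤ C * α k := by
  refine hα.exists_le_mul (D := D) (fun k => norm_nonneg _) hT.nonneg hT.lt_one
    ((norm_nonneg _).trans (hv 0)) fun k => ?_
  rw [hx, map_sub, map_smul, hT.proj_apply,
    show T (x k) - α k • v k - (P (x k) - α k • P (v k))
      = (T (x k) - P (x k)) - α k • (v k - P (v k)) by module]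
  refine (norm_sub_le _ _).trans (add_le_add (hT.contract _) ?_)
  rw [norm_smul, Real.norm_eq_abs, abs_of_pos (hα.pos k), mul_comm]
  have := hα.pos k
  gcongr
  exact (hT.norm_sub_proj_le _).trans (hv k)

/-- The increments of an inexact consensus iteration are of the order of the step size. -/
theorem exists_increment_le (hT : IsAveraging T P ρ) (hα : IsVanishingStep α)
    (hx : ∀ k, x (k + 1) = T (x k) - α k • v k) (hv : ∀ k, ‖v k‖ ≤ D) :
    ∃ C, 0 ≤ C ∧ ∀ k, ‖x (k + 1) - x k‖ ≤ C * α k := by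
  obtain ⟨C, hC, h⟩ := hT.exists_disagreement_le hα hx hv
  have hD : 0 ≤ D := (norm_nonneg _).trans (hv 0)
  refine ⟨2 * C + D, by positivity, fun k => ?_⟩
  have hp := hα.pos k
  have h1 : ‖x (k + 1) - x k‖ ≤ ‖T (x k) - P (x k)‖ + ‖x k - P (x k)‖ + ‖α k • v k‖ := by
    rw [hx, show T (x k) - α k • v k - x k
      = (T (x k) - P (x k)) - (x k - P (x k)) - α k • v k by abel]
    exact (norm_sub_le _ _).trans (add_le_add_left (norm_sub_le _ _) _)
  have h2 := hT.contract (x k)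
  have h3 : ‖α k • v k‖ ≤ D * α k := by
    rw [norm_smul, Real.norm_eq_abs, abs_of_pos hp, mul_comm]
    gcongr
    exact hv k
  have h4 := h k
  nlinarith [hT.lt_one, norm_nonneg (x k - P (x k))]

/-- The descent of the Lyapunov function in one step of a proximal gradient method. -/
theorem lyapunov_descent (hT : IsAveraging T P ρ) {F R : E → ℝ} {L θ a : ℝ} (ha : 0 < a)
    {y z w u : E} (hz : z = T y - a • (w + u))
    (hF : F z ≤ F y + inner ℝ w (z - y) + L / 2 * ‖z - y‖ ^ 2)
    (hR : R z ≤ R y + inner ℝ u (z - y) + θ / (2 * a) * ‖z - y‖ ^ 2) :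
    F z + R z + inner ℝ z (z - T z) / (2 * a) ≤ F y + R y + inner ℝ y (y - T y) / (2 * a)
      - (((2 - θ) / a - L) * ‖z - y‖ ^ 2 - inner ℝ (z - y) ((z - y) - T (z - y)) / a) / 2 := by
  set d := z - y with hd
  have hzy : z = y + d := by simp [hd]
  have e1 : inner ℝ z (z - T z) = inner ℝ y (y - T y) + 2 * inner ℝ (y - T y) d
      + inner ℝ d (d - T d) := by
    rw [hzy, map_add, show y + d - (T y + T d) = (y - T y) + (d - T d) by abel, inner_add_left,
      inner_add_right, inner_add_right]
    have h1 : inner ℝ y (d - T d) = inner ℝ (y - T y) d := by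
      rw [inner_sub_right, inner_sub_left, hT.symm]
    rw [h1, real_inner_comm (y - T y) d]
    ring
  -- The step equation makes the first-order terms of `F + R` cancel the cross term of the quadratic
  -- form, leaving `-‖d‖ ^ 2 / a`.
  have e2 : a * inner ℝ (w + u) d = - inner ℝ (y - T y) d - ‖d‖ ^ 2 := by
    have : a • (w + u) = - (y - T y) - d := by
      rw [hd, hz]; abel
    rw [← real_inner_smul_left, this, inner_sub_left, inner_neg_left, real_inner_self_eq_norm_sq]
  rw [inner_add_left] at e2
  have e3 : inner ℝ w d + inner ℝ u d = (- inner ℝ (y - T y) d - ‖d‖ ^ 2) / a := by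
    rw [eq_div_iff ha.ne']; linarith
  have e4 : inner ℝ y (y - T y) / (2 * a)
      - (((2 - θ) / a - L) * ‖d‖ ^ 2 - inner ℝ d (d - T d) / a) / 2
      = (inner ℝ w d + inner ℝ u d) + L / 2 * ‖d‖ ^ 2 + θ / (2 * a) * ‖d‖ ^ 2
        + inner ℝ z (z - T z) / (2 * a) := by
    rw [e3, e1]
    field_simp
    ring
  linarith

/-- The increase of the Lyapunov function caused by the change of the step size. -/
theorem penalty_increase_le (hT : IsAveraging T P ρ) (hα : IsVanishingStep α) {C : ℝ}
    (hC : ∀ k, ‖x k - P (x k)‖ ≤ C * α k) (k : ℕ) :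
    inner ℝ (x (k + 1)) (x (k + 1) - T (x (k + 1))) / (2 * α (k + 1)) ≤
      inner ℝ (x (k + 1)) (x (k + 1) - T (x (k + 1))) / (2 * α k)
        + C ^ 2 * (α k - α (k + 1)) := by
  set q := inner ℝ (x (k + 1)) (x (k + 1) - T (x (k + 1)))
  have p0 := hα.pos k
  have p1 := hα.pos (k + 1)
  have hmono := hα.anti k.le_succ
  have h1 : q ≤ 2 * (C * α (k + 1)) ^ 2 := by
    refine (hT.inner_sub_apply_le _).trans ?_
    have := hC (k + 1)
    gcongr
  -- The product `α k * α (k + 1)` is the denominator of the difference of the two reciprocals, so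
  -- only the telescoping factor `α k - α (k + 1)` survives.
  have h2 : q ≤ 2 * C ^ 2 * (α k * α (k + 1)) := by
    have : C ^ 2 * (α (k + 1) * α (k + 1)) ≤ C ^ 2 * (α k * α (k + 1)) := by gcongr
    linarith
  have h3 : q / (2 * α (k + 1)) - q / (2 * α k)
      = q / (2 * (α k * α (k + 1))) * (α k - α (k + 1)) := by
    field_simp
  have h4 : q / (2 * (α k * α (k + 1))) ≤ C ^ 2 := by
    rw [div_le_iff₀ (by positivity)]; linarith
  have h5 := mul_le_mul_of_nonneg_right h4 (sub_nonneg.2 hmono)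
  rw [← h3] at h5
  linarith

/-- Convergence of the Lyapunov function of a proximal gradient consensus iteration. -/
theorem lyapunov_convergence (hT : IsAveraging T P ρ) (hα : IsVanishingStep α)
    {g ξ : ℕ → E} (hx : ∀ k, x (k + 1) = T (x k) - α k • (g k + ξ (k + 1)))
    (hv : ∀ k, ‖g k + ξ (k + 1)‖ ≤ D) {F R : E → ℝ} {L θ lam b : ℝ}
    (hF : ∀ k, F (x (k + 1)) ≤ F (x k) + inner ℝ (g k) (x (k + 1) - x k)
      + L / 2 * ‖x (k + 1) - x k‖ ^ 2)
    (hR : ∀ k, R (x (k + 1)) ≤ R (x k) + inner ℝ (ξ (k + 1)) (x (k + 1) - x k)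
      + θ / (2 * α k) * ‖x (k + 1) - x k‖ ^ 2)
    (hlam : ∀ y, lam * ‖y‖ ^ 2 ≤ inner ℝ y (T y)) (hpos : 0 < 1 + lam - θ)
    (hb : ∀ y, b ≤ F y + R y) :
    (∃ l, Tendsto (fun k => F (x k) + R (x k) + inner ℝ (x k) (x k - T (x k)) / (2 * α k))
        atTop (𝓝 l) ∧ Tendsto (fun k => F (x k) + R (x k)) atTop (𝓝 l)) ∧
      Summable fun k => ((α k)⁻¹ * (1 + lam - θ) - L) * ‖x (k + 1) - x k‖ ^ 2 := by
  obtain ⟨C, hC, hdis⟩ := hT.exists_disagreement_le hα hx hv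
  have hq0 : ∀ k, 0 ≤ inner ℝ (x k) (x k - T (x k)) / (2 * α k) := fun k =>
    div_nonneg (hT.inner_sub_apply_nonneg _) (by linarith [hα.pos k])
  -- Early coefficients may be negative. Eventual nonnegativity suffices for both convergence and
  -- summability.
  have hcoef : ∀ᶠ k in atTop, 0 ≤ (α k)⁻¹ * (1 + lam - θ) - L := by
    have h1 : Tendsto (fun k => (α k)⁻¹ * (1 + lam - θ)) atTop atTop := by
      refine Tendsto.atTop_mul_const hpos (tendsto_inv_nhdsGT_zero.comp ?_)
      exact tendsto_nhdsWithin_iff.2 ⟨hα.tendsto_zero, Eventually.of_forall hα.pos⟩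
    filter_upwards [h1.eventually_ge_atTop L] with k hk
    linarith
  have hmain := tendsto_and_summable_of_descent
    (V := fun k => F (x k) + R (x k) + inner ℝ (x k) (x k - T (x k)) / (2 * α k))
    (u := fun k => (((α k)⁻¹ * (1 + lam - θ) - L) * ‖x (k + 1) - x k‖ ^ 2) / 2)
    (e := fun k => C ^ 2 * (α k - α (k + 1))) (b := b)
    (fun k => by linarith [hb (x k), hq0 k])
    (Eventually.of_forall fun k => by
      have p0 := hα.pos k
      have h1 := hT.lyapunov_descent p0 (hx k) (hF k) (hR k)
      have h2 := hT.penalty_increase_le hα hdis k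
      have h3 := hlam (x (k + 1) - x k)
      have h4 : inner ℝ (x (k + 1) - x k) (x (k + 1) - x k - T (x (k + 1) - x k)) / α k
          ≤ (1 - lam) * ‖x (k + 1) - x k‖ ^ 2 / α k := by
        gcongr
        rw [inner_sub_right, real_inner_self_eq_norm_sq]
        linarith
      have h5 : ((2 - θ) / α k - L) * ‖x (k + 1) - x k‖ ^ 2
          - (1 - lam) * ‖x (k + 1) - x k‖ ^ 2 / α k
          = ((α k)⁻¹ * (1 + lam - θ) - L) * ‖x (k + 1) - x k‖ ^ 2 := by
        field_simp
        ring
      linarith)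
    (by
      filter_upwards [hcoef] with k hk
      positivity)
    (hα.summable_sub.mul_left _)
  obtain ⟨⟨l, hl⟩, hs⟩ := hmain
  refine ⟨⟨l, hl, ?_⟩, ?_⟩
  · have hzero : Tendsto (fun k => inner ℝ (x k) (x k - T (x k)) / (2 * α k)) atTop (𝓝 0) := by
      refine squeeze_zero hq0 (g := fun k => C ^ 2 * α k) (fun k => ?_) ?_
      · have p0 := hα.pos k
        rw [div_le_iff₀ (by positivity)]
        have h1 := hT.inner_sub_apply_le (x k)
        have h2 : ‖x k - P (x k)‖ ^ 2 ≤ (C * α k) ^ 2 := by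
          have := hdis k
          gcongr
        linarith
      · simpa using hα.tendsto_zero.const_mul (C ^ 2)
    simpa using hl.sub hzero
  · refine (hs.mul_left 2).congr fun k => ?_
    ring

end IsAveraging

end Dynamics

/-! ### Slowly varying directions and the ergodic estimate -/

section SlowVariation

/-- Convexity of the square gives `(ρ₁ * s + e) ^ 2 ≤ ρ₁ * s ^ 2 + e ^ 2 / (1 - ρ₁)`, keeping the
factor below one. Since `δ ≤ a`, dividing `δ ^ 2` by `a` leaves at most `δ`, which will be a
telescoping decrement of the step size. -/
theorem sq_div_le_of_perturbed_contraction {s s' p c D ρ₁ ρ₂ a a' δ : ℝ}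
    (hs' : 0 ≤ s') (hρ : 0 ≤ ρ₁) (hρ1 : ρ₁ < 1)
    (ha : 0 < a) (ha' : 0 < a') (hδ : 0 ≤ δ) (hδa : δ ≤ a) (h2 : a / a' ≤ 2)
    (hρ2 : a / a' * ρ₁ ≤ ρ₂) (h : s' ≤ ρ₁ * s + c * a * p + 2 * D * δ) :
    s' ^ 2 / a' ≤ ρ₂ * (s ^ 2 / a) + 4 * c ^ 2 / (1 - ρ₁) * a ^ 2 * (p ^ 2 / a)
      + 16 * D ^ 2 / (1 - ρ₁) * δ := by
  have h1 : 0 < 1 - ρ₁ := by linarith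
  set e := c * a * p + 2 * D * δ with he
  have hsq : s' ^ 2 ≤ ρ₁ * s ^ 2 + e ^ 2 / (1 - ρ₁) := by
    have h3 : s' ^ 2 ≤ (ρ₁ * s + e) ^ 2 := by
      apply pow_le_pow_left₀ hs'
      linarith
    have h4 : ρ₁ * s ^ 2 + e ^ 2 / (1 - ρ₁) - (ρ₁ * s + e) ^ 2
        = ρ₁ * ((1 - ρ₁) * s - e) ^ 2 / (1 - ρ₁) := by
      field_simp
      ring
    have h5 : 0 ≤ ρ₁ * ((1 - ρ₁) * s - e) ^ 2 / (1 - ρ₁) := by positivity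
    linarith
  have he2 : e ^ 2 / a ≤ 2 * c ^ 2 * a ^ 2 * (p ^ 2 / a) + 8 * D ^ 2 * δ := by
    have h3 : e ^ 2 ≤ 2 * (c * a * p) ^ 2 + 2 * (2 * D * δ) ^ 2 := by
      nlinarith [sq_nonneg (c * a * p - 2 * D * δ)]
    have h4 : δ ^ 2 ≤ δ * a := by nlinarith
    have h5 : D ^ 2 * δ ^ 2 ≤ D ^ 2 * (δ * a) := by gcongr
    rw [div_le_iff₀ ha]
    have h6 : (2 * c ^ 2 * a ^ 2 * (p ^ 2 / a) + 8 * D ^ 2 * δ) * a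
        = 2 * (c * a * p) ^ 2 + 8 * (D ^ 2 * (δ * a)) := by
      field_simp
    linarith
  calc s' ^ 2 / a' ≤ (ρ₁ * s ^ 2 + e ^ 2 / (1 - ρ₁)) / a' := by gcongr
    _ = (a / a' * ρ₁) * (s ^ 2 / a) + a / a' * (1 / (1 - ρ₁)) * (e ^ 2 / a) := by
      field_simp
    _ ≤ ρ₂ * (s ^ 2 / a) + 2 * (1 / (1 - ρ₁))
        * (2 * c ^ 2 * a ^ 2 * (p ^ 2 / a) + 8 * D ^ 2 * δ) := by gcongr
    _ = _ := by ring

variable {E : Type*} [NormedAddCommGroup E] [InnerProductSpace ℝ E]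
  {T P : E →ₗ[ℝ] E} {ρ : ℝ} {α : ℕ → ℝ} {x v : ℕ → E} {D : ℝ}

namespace IsAveraging

/-- The disagreement of the increments contracts if the directions vary slowly. -/
theorem increment_disagreement_le (hT : IsAveraging T P ρ) (hα : IsVanishingStep α)
    (hx : ∀ k, x (k + 1) = T (x k) - α k • v k) (hv : ∀ k, ‖v k‖ ≤ D) {A : ℝ} (hA : 0 ≤ A)
    {k : ℕ} (hslow : ‖v (k + 1) - v k‖ ≤ A * (‖x (k + 1) - x k‖ + ‖x (k + 2) - x (k + 1)‖))
    (hsmall : α (k + 1) * A ≤ 1 / 2) :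
    ‖(x (k + 2) - x (k + 1)) - P (x (k + 2) - x (k + 1))‖ ≤
      (ρ + 6 * A * α k) * ‖(x (k + 1) - x k) - P (x (k + 1) - x k)‖
        + 6 * A * α k * ‖P (x (k + 1) - x k)‖ + 2 * D * (α k - α (k + 1)) := by
  have p1 := hα.pos (k + 1)
  have hδ : 0 ≤ α k - α (k + 1) := sub_nonneg.2 (hα.anti k.le_succ)
  set δ := α k - α (k + 1) with hδdef
  set d := x (k + 1) - x k with hd
  set d' := x (k + 2) - x (k + 1) with hd'
  set w := v (k + 1) - v k with hw
  have hrec : d' = T d - α (k + 1) • w + δ • v k := by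
    rw [hd', hx (k + 1)]
    nth_rw 2 [hx k]
    rw [hd, map_sub, hw, hδdef]
    module
  have hδv : ‖δ • v k‖ ≤ D * δ := by
    rw [norm_smul, Real.norm_eq_abs, abs_of_nonneg hδ, mul_comm]
    gcongr
    exact hv k
  have hw2 : ‖α (k + 1) • w‖ ≤ α (k + 1) * (A * (‖d‖ + ‖d'‖)) := by
    rw [norm_smul, Real.norm_eq_abs, abs_of_pos p1]
    gcongr
  -- Slow variation bounds `w` through `d'` itself. The small step moves half of `‖d'‖` to the left,
  -- and doubling `(2 + 1 / 2) * ‖d‖ + D * δ` gives the constants.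
  have hd5 : ‖d'‖ ≤ 5 * ‖d‖ + 2 * D * δ := by
    have h1 : ‖d'‖ ≤ ‖T d‖ + ‖α (k + 1) • w‖ + ‖δ • v k‖ := by
      rw [hrec]
      exact (norm_add_le _ _).trans (add_le_add_left (norm_sub_le _ _) _)
    have h2 := hT.norm_apply_le d
    have h3 : α (k + 1) * (A * (‖d‖ + ‖d'‖)) ≤ 1 / 2 * (‖d‖ + ‖d'‖) := by
      rw [← mul_assoc]; gcongr
    linarith
  have hw3 : ‖α (k + 1) • w‖ ≤ 6 * A * α k * ‖d‖ + D * δ := by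
    refine hw2.trans ?_
    have hD : 0 ≤ D := (norm_nonneg _).trans (hv 0)
    calc α (k + 1) * (A * (‖d‖ + ‖d'‖))
        ≤ α (k + 1) * (A * (‖d‖ + (5 * ‖d‖ + 2 * D * δ))) := by gcongr
      _ = 6 * A * α (k + 1) * ‖d‖ + (α (k + 1) * A) * (2 * D * δ) := by ring
      _ ≤ 6 * A * α k * ‖d‖ + 1 / 2 * (2 * D * δ) := by
        gcongr
        exact hα.anti k.le_succ
      _ = _ := by ring
  have hsplit : d' - P d' = (T d - P d) - (α (k + 1) • w - P (α (k + 1) • w))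
      + (δ • v k - P (δ • v k)) := by
    rw [hrec, map_add P, map_sub P, hT.proj_apply]
    abel
  have h1 : ‖d' - P d'‖ ≤ ‖T d - P d‖ + ‖α (k + 1) • w‖ + ‖δ • v k‖ := by
    rw [hsplit]
    refine (norm_add_le _ _).trans (add_le_add ((norm_sub_le _ _).trans
      (add_le_add le_rfl (hT.norm_sub_proj_le _))) (hT.norm_sub_proj_le _))
  have h2 := hT.contract d
  have h3 : ‖d‖ ≤ ‖d - P d‖ + ‖P d‖ := by simpa using norm_add_le (d - P d) (P d)
  have h4 : 6 * A * α k * ‖d‖ ≤ 6 * A * α k * (‖d - P d‖ + ‖P d‖) := by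
    have := hα.pos k
    gcongr
  linarith

/-- If the search directions vary slowly, then their averages tend to zero. -/
theorem tendsto_proj_zero (hT : IsAveraging T P ρ) (hα : IsVanishingStep α)
    (hdiv : ¬ Summable α) {g ξ : ℕ → E}
    (hx : ∀ k, x (k + 1) = T (x k) - α k • (g k + ξ (k + 1)))
    (hv : ∀ k, ‖g k + ξ (k + 1)‖ ≤ D) {F R : E → ℝ} {L b : ℝ}
    (hF : ∀ k, F (x (k + 1)) ≤ F (x k) + inner ℝ (g k) (x (k + 1) - x k)
      + L / 2 * ‖x (k + 1) - x k‖ ^ 2)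
    (hR : ∀ k, R (x (k + 1)) ≤ R (x k) + inner ℝ (ξ (k + 1)) (x (k + 1) - x k)
      + 1 / (2 * α k) * ‖x (k + 1) - x k‖ ^ 2)
    (hb : ∀ y, b ≤ F y + R y) {A : ℝ} (hA : 0 ≤ A)
    (hslow : ∀ᶠ k in atTop, ‖(g (k + 1) + ξ (k + 2)) - (g k + ξ (k + 1))‖
      ≤ A * (‖x (k + 1) - x k‖ + ‖x (k + 2) - x (k + 1)‖)) :
    Tendsto (fun k => P (g k + ξ (k + 1))) atTop (𝓝 0) := by
  obtain ⟨C, hC, hdis⟩ := hT.exists_disagreement_le hα hx hv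
  obtain ⟨C', hC', hinc⟩ := hT.exists_increment_le hα hx hv
  have hρ0 := hT.nonneg
  have hρ1 := hT.lt_one
  -- Two margins are reserved: `ρ₁` absorbs the perturbation `6 * A * α k`, and `ρ₂` the ratio of
  -- consecutive steps.
  set ρ₁ := (1 + ρ) / 2 with hρ₁
  set ρ₂ := (1 + ρ₁) / 2 with hρ₂
  have h01 : 0 ≤ ρ₁ := by linarith
  have h11 : ρ₁ < 1 := by linarith
  have h21 : ρ₂ < 1 := by linarith
  set M := 1 / (1 - ρ₂) with hM
  have hM0 : 0 < M := by rw [hM]; apply div_pos one_pos; linarith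
  have hMeq : M * ρ₂ = M - 1 := by
    have : M * (1 - ρ₂) = 1 := by rw [hM]; apply div_mul_cancel₀; linarith
    linarith
  set K₁ := 4 * (6 * A) ^ 2 / (1 - ρ₁) with hK₁
  set K₂ := 16 * D ^ 2 / (1 - ρ₁) with hK₂
  have hlim : ∀ c : ℝ, Tendsto (fun k => c * α k) atTop (𝓝 0) := fun c => by
    simpa using hα.tendsto_zero.const_mul c
  have hratio : Tendsto (fun k => α k / α (k + 1) * ρ₁) atTop (𝓝 ρ₁) := by
    simpa using hα.tendsto_ratio.mul_const ρ₁
  have hq0 : ∀ k, 0 ≤ inner ℝ (x k) (x k - T (x k)) / (2 * α k) := fun k =>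
    div_nonneg (hT.inner_sub_apply_nonneg _) (by linarith [hα.pos k])
  set d : ℕ → E := fun k => x (k + 1) - x k with hd
  set a : ℕ → ℝ := fun k => ‖d k - P (d k)‖ ^ 2 / α k with ha
  set β : ℕ → ℝ := fun k => ‖P (d k)‖ ^ 2 / α k with hβ
  have ha0 : ∀ k, 0 ≤ a k := fun k => div_nonneg (sq_nonneg _) (hα.pos k).le
  have hβ0 : ∀ k, 0 ≤ β k := fun k => div_nonneg (sq_nonneg _) (hα.pos k).le
  have hrec : ∀ᶠ k in atTop, a (k + 1) ≤ ρ₂ * a k + K₁ * α k ^ 2 * β k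
      + K₂ * (α k - α (k + 1)) := by
    filter_upwards [hslow, (hlim A).eventually (eventually_lt_nhds (show (0:ℝ) < 1 / 2 by norm_num)),
      (hlim (6 * A)).eventually (eventually_lt_nhds (show 0 < (1 - ρ) / 2 by linarith)),
      hα.le_two_mul, hratio.eventually (eventually_lt_nhds (show ρ₁ < ρ₂ by linarith))]
      with k h1 h2 h3 h4 h5
    have p0 := hα.pos k
    have p1 := hα.pos (k + 1)
    have hmono := hα.anti k.le_succ
    have h6 : α (k + 1) * A ≤ 1 / 2 := by
      have : A * α (k + 1) ≤ A * α k := by gcongr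
      linarith
    have h7 := hT.increment_disagreement_le hα hx hv hA h1 h6
    refine sq_div_le_of_perturbed_contraction (norm_nonneg _) h01 h11 p0 p1
      (sub_nonneg.2 hmono) (by linarith) ((div_le_iff₀ p1).2 h4) h5.le (h7.trans ?_)
    have h8 : ρ + 6 * A * α k ≤ ρ₁ := by linarith
    have := mul_le_mul_of_nonneg_right h8 (norm_nonneg (d k - P (d k)))
    linarith
  -- With `θ = 1` and `L * α k < 1 / 2`, the Lyapunov function alone decreases by at least `β k / 4
  -- - 3 * a k / 4`, up to telescoping errors. As `M * ρ₂ = M - 1`, the extra term `M * a k` gains a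
  -- full `a k` and costs at most `β k / 8`, so a decrease of `β k / 8` remains.
  have hdesc := tendsto_and_summable_of_descent
    (V := fun k => F (x k) + R (x k) + inner ℝ (x k) (x k - T (x k)) / (2 * α k) + M * a k)
    (u := fun k => β k / 8)
    (e := fun k => (C ^ 2 + M * K₂) * (α k - α (k + 1))) (b := b)
    (fun k => by
      have := mul_nonneg hM0.le (ha0 k)
      linarith [hb (x k), hq0 k])
    (by
      filter_upwards [hrec, (hlim L).eventually (eventually_lt_nhds (show (0:ℝ) < 1 / 2 by norm_num)),
        (hlim 1).eventually (eventually_lt_nhds (show (0:ℝ) < 1 by norm_num)),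
        (hlim (M * K₁)).eventually (eventually_lt_nhds (show (0:ℝ) < 1 / 8 by norm_num))]
        with k h1 h2 h3 h4
      have p0 := hα.pos k
      have h5 := hT.lyapunov_descent (θ := 1) p0 (hx k) (hF k) (hR k)
      have h6 := hT.penalty_increase_le hα hdis k
      have h7 : inner ℝ (d k) (d k - T (d k)) / α k ≤ 2 * a k := by
        rw [ha, ← mul_div_assoc]
        gcongr
        exact hT.inner_sub_apply_le _
      have h8 : ((2 - 1) / α k - L) * ‖d k‖ ^ 2 = (1 - L * α k) * (a k + β k) := by
        rw [hT.norm_sq_eq (d k)]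
        simp only [ha, hβ]
        field_simp
        ring
      have h9 : 1 / 2 * (a k + β k) ≤ (1 - L * α k) * (a k + β k) := by
        have := ha0 k
        have := hβ0 k
        gcongr
        linarith
      have h10 : M * K₁ * α k ^ 2 * β k ≤ 1 / 8 * β k := by
        have := hβ0 k
        gcongr
        have hK0 : 0 ≤ M * K₁ := by
          have : 0 < 1 - ρ₁ := by linarith
          positivity
        nlinarith
      have h11 := mul_le_mul_of_nonneg_left h1 hM0.le
      have h12 : M * (ρ₂ * a k + K₁ * α k ^ 2 * β k + K₂ * (α k - α (k + 1)))
          = (M - 1) * a k + M * K₁ * α k ^ 2 * β k + M * K₂ * (α k - α (k + 1)) := by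
        rw [← hMeq]; ring
      have h13 := ha0 k
      simp only [hd] at h7 h8
      linarith)
    (Eventually.of_forall fun k => by have := hβ0 k; positivity)
    (hα.summable_sub.mul_left _)
  -- Since `P` annihilates `T - id`, the averaged increment is exactly `-α k` times the averaged
  -- direction.
  have hPd : ∀ k, β k = α k * ‖P (g k + ξ (k + 1))‖ ^ 2 := by
    intro k
    have p0 := hα.pos k
    have : P (d k) = -(α k • P (g k + ξ (k + 1))) := by
      simp only [hd]
      rw [hx, map_sub, map_sub, hT.proj_apply, map_smul]
      abel
    simp only [hβ]
    rw [this, norm_neg, norm_smul, Real.norm_eq_abs, abs_of_pos p0]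
    field_simp
  refine hα.tendsto_zero_of_summable hdiv (C := A * (C' + C')) ?_ (by positivity) ?_
  · refine (hdesc.2.mul_left 8).congr fun k => ?_
    rw [← hPd]
    ring
  · filter_upwards [hslow] with k hk
    rw [← map_sub]
    refine (hT.norm_proj_le _).trans (hk.trans ?_)
    rw [mul_assoc]
    gcongr
    have h1 := hinc k
    have h2 : ‖x (k + 2) - x (k + 1)‖ ≤ C' * α k :=
      (hinc (k + 1)).trans (mul_le_mul_of_nonneg_left (hα.anti k.le_succ) hC')
    linarith

/-- The basic estimate for the ergodic objective in the convex case. -/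
theorem ergodic_estimate (hT : IsAveraging T P ρ) (hα : IsVanishingStep α) {g ξ : ℕ → E}
    (hx : ∀ k, x (k + 1) = T (x k) - α k • (g k + ξ (k + 1)))
    (hv : ∀ k, ‖g k + ξ (k + 1)‖ ≤ D) {F R : E → ℝ} {B M : ℝ} (hB : 0 ≤ B) (hM : 0 ≤ M)
    (hξ : ∀ k, ‖ξ (k + 1)‖ ≤ B) (hFl : ∀ u w, |F u - F w| ≤ M * ‖u - w‖)
    (hRl : ∀ u w, |R u - R w| ≤ M * ‖u - w‖)
    (hF : ∀ k u, F (x k) + inner ℝ (g k) (u - x k) ≤ F u)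
    (hR : ∀ k u, R (x (k + 1)) + inner ℝ (ξ (k + 1)) (u - x (k + 1)) ≤ R u)
    {y : E} (hy : P y = y) :
    ∃ C, 0 ≤ C ∧ ∀ k, α k * (F (P (x (k + 1))) + R (P (x (k + 1))) - (F y + R y)) ≤
      (‖P (x k) - y‖ ^ 2 - ‖P (x (k + 1)) - y‖ ^ 2) / 2 + C * α k ^ 2 := by
  obtain ⟨C₁, hC₁, hdis⟩ := hT.exists_disagreement_le hα hx hv
  obtain ⟨C₂, hC₂, hinc⟩ := hT.exists_increment_le hα hx hv
  have hD : 0 ≤ D := (norm_nonneg _).trans (hv 0)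
  refine ⟨D ^ 2 / 2 + M * (C₁ + C₂) + M * C₁ + B * C₂ + D * C₁, by positivity, fun k => ?_⟩
  have p0 := hα.pos k
  have hmono := hα.anti k.le_succ
  set w := g k + ξ (k + 1) with hw
  -- Mixing preserves the average, so the averages take an exact step along `P w`. The gradients are
  -- evaluated at `x k` and `x (k + 1)` instead, at distance `O(α k)`, and all constants below come
  -- from these displacements.
  have h1 : P (x (k + 1)) - y = (P (x k) - y) - α k • P w := by
    rw [hx, map_sub, hT.proj_apply, map_smul]
    abel
  have h2 : ‖P (x (k + 1)) - y‖ ^ 2 = ‖P (x k) - y‖ ^ 2 - 2 * α k * inner ℝ w (P (x k) - y)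
      + α k ^ 2 * ‖P w‖ ^ 2 := by
    rw [h1, norm_sub_sq_real, norm_smul, Real.norm_eq_abs, abs_of_pos p0, inner_smul_right,
      real_inner_comm, hT.proj_symm, map_sub, hT.proj_idem, hy]
    ring
  have h3 : ‖P w‖ ≤ D := (hT.norm_proj_le _).trans (hv k)
  have h4 : ‖P w‖ ^ 2 ≤ D ^ 2 := by gcongr
  have h5 : inner ℝ w (x k - P (x k)) = inner ℝ w (x k - y) - inner ℝ w (P (x k) - y) := by
    rw [← inner_sub_right]
    congr 1
    abel
  have h6 : inner ℝ w (x k - P (x k)) ≤ D * (C₁ * α k) :=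
    (real_inner_le_norm _ _).trans (mul_le_mul (hv k) (hdis k) (norm_nonneg _) hD)
  have h7 := hF k y
  have h8 := hR k y
  have h9 : inner ℝ w (x k - y) = - inner ℝ (g k) (y - x k)
      - inner ℝ (ξ (k + 1)) (y - x (k + 1)) - inner ℝ (ξ (k + 1)) (x (k + 1) - x k) := by
    rw [hw, inner_add_left, show x k - y = -(y - x k) by abel, inner_neg_right, inner_neg_right,
      show y - x k = (y - x (k + 1)) + (x (k + 1) - x k) by abel,
      inner_add_right (ξ (k + 1))]
    ring
  have h10 : inner ℝ (ξ (k + 1)) (x (k + 1) - x k) ≤ B * (C₂ * α k) :=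
    (real_inner_le_norm _ _).trans (mul_le_mul (hξ k) (hinc k) (norm_nonneg _) hB)
  have hdis1 : ‖P (x (k + 1)) - x (k + 1)‖ ≤ C₁ * α k := by
    rw [norm_sub_rev]
    exact (hdis (k + 1)).trans (mul_le_mul_of_nonneg_left hmono hC₁)
  have h11 : F (P (x (k + 1))) - F (x k) ≤ M * ((C₁ + C₂) * α k) := by
    refine (le_abs_self _).trans ((hFl _ _).trans (mul_le_mul_of_nonneg_left ?_ hM))
    have : ‖P (x (k + 1)) - x k‖ ≤ ‖P (x (k + 1)) - x (k + 1)‖ + ‖x (k + 1) - x k‖ := by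
      simpa using norm_add_le (P (x (k + 1)) - x (k + 1)) (x (k + 1) - x k)
    linarith [hinc k]
  have h12 : R (P (x (k + 1))) - R (x (k + 1)) ≤ M * (C₁ * α k) :=
    (le_abs_self _).trans ((hRl _ _).trans (mul_le_mul_of_nonneg_left hdis1 hM))
  have h13 : inner ℝ w (P (x k) - y) ≥ F (P (x (k + 1))) + R (P (x (k + 1))) - (F y + R y)
      - (M * (C₁ + C₂) + M * C₁ + B * C₂ + D * C₁) * α k := by
    linarith
  have h14 := mul_le_mul_of_nonneg_left h13 p0.le
  have h15 : α k ^ 2 * ‖P w‖ ^ 2 ≤ α k ^ 2 * D ^ 2 := by gcongr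
  nlinarith

end IsAveraging

end SlowVariation

/-! ### Contraction from spectral bounds -/

section Averaging

variable {E : Type*} [NormedAddCommGroup E] [InnerProductSpace ℝ E]

/-- For an eigenvalue `t`, `1 - t ^ 2 - (1 + lam) / 2 * (1 - t) ^ 2` is half the sum of `(t - lam) *
(1 - t) ^ 2` and `(1 - t) * (1 + t) ^ 2`. These two terms are the spectral bounds tested at `z - T
z` and `z + T z`, so no diagonalization is needed. -/
theorem norm_apply_sq_le_of_symmetric {T : E →ₗ[ℝ] E}
    (hsymm : ∀ x y, inner ℝ (T x) y = inner ℝ x (T y))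
    (hle : ∀ x, inner ℝ x (T x) ≤ ‖x‖ ^ 2) {lam : ℝ}
    (hlam : ∀ x, lam * ‖x‖ ^ 2 ≤ inner ℝ x (T x)) (z : E) :
    ‖T z‖ ^ 2 ≤ ‖z‖ ^ 2 - (1 + lam) / 2 * ‖z - T z‖ ^ 2 := by
  have h1 := hlam (z - T z)
  have h2 := hle (z + T z)
  have e1 := hsymm z (T z)
  have e2 := real_inner_comm z (T z)
  have e3 := real_inner_comm z (T (T z))
  rw [norm_sub_sq_real] at h1 ⊢
  rw [norm_add_sq_real] at h2
  simp only [map_sub, map_add, inner_sub_left, inner_sub_right, inner_add_left, inner_add_right,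
    real_inner_self_eq_norm_sq] at h1 h2 e1
  linarith

/-- A symmetric operator with `lam ≤ T ≤ 1`, `lam > -1`, whose fixed vectors are the range of the
projection `P`, averages towards the range of `P`. -/
theorem exists_isAveraging [FiniteDimensional ℝ E] {T P : E →ₗ[ℝ] E}
    (hsymm : ∀ x y, inner ℝ (T x) y = inner ℝ x (T y))
    (hPsymm : ∀ x y, inner ℝ (P x) y = inner ℝ x (P y)) (hPP : ∀ x, P (P x) = P x)
    (hTP : ∀ x, T (P x) = P x) (hPT : ∀ x, P (T x) = P x) (hfix : ∀ x, T x = x → P x = x)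
    (hle : ∀ x, inner ℝ x (T x) ≤ ‖x‖ ^ 2) {lam : ℝ} (hlam1 : -1 < lam)
    (hlam : ∀ x, lam * ‖x‖ ^ 2 ≤ inner ℝ x (T x)) : ∃ ρ, IsAveraging T P ρ := by
  -- Fixed vectors of `T` in `ker P` vanish, so `id - T` is injective there. In finite dimension it
  -- is then bounded below, which serves as the spectral gap.
  obtain ⟨K, hK, hanti⟩ := ((LinearMap.id - T).domRestrict (LinearMap.ker P)).exists_antilipschitzWith
    (by
      rw [LinearMap.ker_eq_bot']
      rintro ⟨z, hz⟩ h
      rw [LinearMap.mem_ker] at hz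
      simp only [LinearMap.domRestrict_apply, LinearMap.sub_apply, LinearMap.id_coe, id_eq,
        sub_eq_zero] at h
      have := hfix z h.symm
      rw [hz] at this
      exact Subtype.ext this.symm)
  have hbound : ∀ z, P z = 0 → ‖z‖ ≤ K * ‖z - T z‖ := by
    intro z hz
    have := hanti.le_mul_dist ⟨z, LinearMap.mem_ker.2 hz⟩ 0
    simpa using this
  have hK' : (0 : ℝ) < K := hK
  set κ := (1 + lam) / 2 / (K : ℝ) ^ 2 with hκ
  have hκ0 : 0 < κ := by
    have : 0 < 1 + lam := by linarith
    positivity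
  refine ⟨Real.sqrt (max 0 (1 - κ)), hsymm, hPsymm, hPP, hTP, hPT, Real.sqrt_nonneg _, ?_, ?_⟩
  · rw [Real.sqrt_lt' one_pos]
    simp [hκ0]
  · intro x
    set z := x - P x with hz
    have hPz : P z = 0 := by rw [hz, map_sub, hPP, sub_self]
    have hTz : T x - P x = T z := by rw [hz, map_sub, hTP]
    rw [hTz]
    refine abs_le_of_sq_le_sq' ?_ (by positivity) |>.2
    have h1 := norm_apply_sq_le_of_symmetric hsymm hle hlam z
    have h2 : ‖z‖ ^ 2 ≤ (K : ℝ) ^ 2 * ‖z - T z‖ ^ 2 := by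
      rw [← mul_pow]
      have := hbound z hPz
      gcongr
    have h3 : κ * ‖z‖ ^ 2 ≤ (1 + lam) / 2 * ‖z - T z‖ ^ 2 := by
      calc κ * ‖z‖ ^ 2 ≤ κ * ((K : ℝ) ^ 2 * ‖z - T z‖ ^ 2) := by gcongr
        _ = _ := by rw [hκ]; field_simp
    rw [mul_pow, Real.sq_sqrt (le_max_left _ _)]
    calc ‖T z‖ ^ 2 ≤ (1 - κ) * ‖z‖ ^ 2 := by linarith
      _ ≤ _ := by gcongr; exact le_max_right _ _

end Averaging

/-! ### The mixing matrix -/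

section Network

variable {n p : ℕ}

/-- Multiplication by `W` as a linear map. -/
def mixLinear (W : Matrix (Fin n) (Fin n) ℝ) : Stack n p →ₗ[ℝ] Stack n p where
  toFun := mix W
  map_add' x y := by
    ext i : 1
    simp [mix, smul_add, Finset.sum_add_distrib]
  map_smul' c x := by
    ext i : 1
    simp only [mix, PiLp.smul_apply, RingHom.id_apply, Finset.smul_sum]
    exact Finset.sum_congr rfl fun j _ => smul_comm _ _ _

/-- Averaging as a linear map. -/
def avgLinear : Stack n p →ₗ[ℝ] Stack n p where
  toFun := avg
  map_add' x y := by
    ext i : 1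
    simp [avg, Finset.sum_add_distrib]
  map_smul' c x := by
    ext i : 1
    simp only [avg, PiLp.smul_apply, RingHom.id_apply, ← Finset.smul_sum]
    exact smul_comm _ _ _

theorem mixLinear_apply (W : Matrix (Fin n) (Fin n) ℝ) (x : Stack n p) :
    mixLinear W x = mix W x := rfl

theorem avgLinear_apply (x : Stack n p) : avgLinear x = avg x := rfl

/-- The `c`-th column of a stack. -/
def column (x : Stack n p) (c : Fin p) : Fin n → ℝ := fun i => x i c

theorem column_mix (W : Matrix (Fin n) (Fin n) ℝ) (x : Stack n p) (c : Fin p) :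
    column (mix W x) c = W.mulVec (column x c) := by
  ext i
  simp [column, mix, Matrix.mulVec, dotProduct]

theorem inner_eq_sum_column (x y : Stack n p) :
    inner ℝ x y = ∑ c, column x c ⬝ᵥ column y c := by
  simp only [PiLp.inner_apply, column, dotProduct]
  rw [Finset.sum_comm]
  refine Finset.sum_congr rfl fun i _ => Finset.sum_congr rfl fun c _ => ?_
  simp [mul_comm]

theorem norm_sq_eq_sum_column (x : Stack n p) :
    ‖x‖ ^ 2 = ∑ c, column x c ⬝ᵥ column x c := by
  rw [← real_inner_self_eq_norm_sq, inner_eq_sum_column]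

/-- Shifting by `lamMin W` translates the spectrum into the nonnegative reals, so the shifted matrix
is positive semidefinite. -/
theorem dotProduct_mulVec_ge_lamMin {W : Matrix (Fin n) (Fin n) ℝ} (hW : W.IsHermitian)
    (y : Fin n → ℝ) : lamMin W * (y ⬝ᵥ y) ≤ y ⬝ᵥ W.mulVec y := by
  have hH : (W - lamMin W • (1 : Matrix (Fin n) (Fin n) ℝ)).IsHermitian := by
    refine hW.sub ?_
    rw [Matrix.IsHermitian, Matrix.conjTranspose_smul, Matrix.conjTranspose_one]
    simp
  have hpsd : (W - lamMin W • (1 : Matrix (Fin n) (Fin n) ℝ)).PosSemidef := by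
    rw [hH.posSemidef_iff_eigenvalues_nonneg]
    intro i
    have h1 := hH.eigenvalues_mem_spectrum_real i
    have h2 : hH.eigenvalues i + lamMin W ∈ spectrum ℝ W := by
      have h4 := spectrum.add_mem_add_iff (R := ℝ) (a := W - lamMin W • 1)
        (r := hH.eigenvalues i) (s := lamMin W)
      rw [Algebra.algebraMap_eq_smul_one, add_sub_cancel] at h4
      exact h4.2 h1
    have h3 : lamMin W ≤ hH.eigenvalues i + lamMin W := by
      refine csInf_le ?_ h2
      rw [hW.spectrum_real_eq_range_eigenvalues]
      exact (Set.finite_range _).bddBelow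
    simpa using h3
  have := hpsd.dotProduct_mulVec_nonneg y
  simp only [star_trivial, Matrix.sub_mulVec, Matrix.smul_mulVec, Matrix.one_mulVec,
    dotProduct_sub, dotProduct_smul, smul_eq_mul] at this
  linarith

namespace IsMixingMatrix

variable {G : SimpleGraph (Fin n)} {W : Matrix (Fin n) (Fin n) ℝ}

theorem isHermitian (hW : IsMixingMatrix G W) : W.IsHermitian := by
  rw [Matrix.IsHermitian, Matrix.conjTranspose_eq_transpose_of_trivial]
  exact hW.symm

theorem lamMin_gt [NeZero n] (hW : IsMixingMatrix G W) : -1 < lamMin W := by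
  have hmem : lamMin W ∈ spectrum ℝ W := by
    rw [lamMin, hW.isHermitian.spectrum_real_eq_range_eigenvalues]
    exact (Set.range_nonempty _).csInf_mem (Set.finite_range _)
  have h1 : lamMin W + 1 ∈ spectrum ℝ (W + 1) := by
    have := spectrum.add_mem_add_iff (R := ℝ) (a := W) (r := lamMin W) (s := 1)
    rw [map_one, add_comm 1 W] at this
    exact this.2 hmem
  rw [hW.neg_one_lt.isHermitian.spectrum_real_eq_range_eigenvalues] at h1
  obtain ⟨i, hi⟩ := h1
  have := hW.neg_one_lt.eigenvalues_pos i
  linarith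

theorem mulVec_one (hW : IsMixingMatrix G W) : W.mulVec (fun _ => 1) = fun _ => 1 := by
  have h1 : (fun _ => (1 : ℝ)) ∈ LinearMap.ker (Matrix.toLin' (1 - W)) := by
    rw [hW.null_space]
    exact Submodule.mem_span_singleton_self _
  rw [LinearMap.mem_ker, Matrix.toLin'_apply, Matrix.sub_mulVec, Matrix.one_mulVec,
    sub_eq_zero] at h1
  exact h1.symm

theorem sum_row (hW : IsMixingMatrix G W) (i : Fin n) : ∑ j, W i j = 1 := by
  have := congrFun hW.mulVec_one i
  simpa [Matrix.mulVec, dotProduct] using this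

theorem sum_col (hW : IsMixingMatrix G W) (j : Fin n) : ∑ i, W i j = 1 := by
  rw [← hW.sum_row j]
  exact Finset.sum_congr rfl fun i _ => hW.symm.apply j i

theorem lamMin_mul_le_inner (hW : IsMixingMatrix G W) (x : Stack n p) :
    lamMin W * ‖x‖ ^ 2 ≤ inner ℝ x (mixLinear W x) := by
  rw [mixLinear_apply, norm_sq_eq_sum_column, inner_eq_sum_column, Finset.mul_sum]
  refine Finset.sum_le_sum fun c _ => ?_
  rw [column_mix]
  exact dotProduct_mulVec_ge_lamMin hW.isHermitian _

theorem inner_le (hW : IsMixingMatrix G W) (x : Stack n p) :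
    inner ℝ x (mixLinear W x) ≤ ‖x‖ ^ 2 := by
  rw [mixLinear_apply, norm_sq_eq_sum_column, inner_eq_sum_column]
  refine Finset.sum_le_sum fun c _ => ?_
  rw [column_mix]
  have := hW.le_one.dotProduct_mulVec_nonneg (column x c)
  simp only [star_trivial, Matrix.sub_mulVec, Matrix.one_mulVec, dotProduct_sub] at this
  linarith

theorem inner_mix (hW : IsMixingMatrix G W) (x y : Stack n p) :
    inner ℝ (mixLinear W x) y = inner ℝ x (mixLinear W y) := by
  simp only [mixLinear_apply, inner_eq_sum_column, column_mix]
  refine Finset.sum_congr rfl fun c _ => ?_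
  rw [Matrix.dotProduct_mulVec, ← Matrix.mulVec_transpose, hW.symm]

theorem exists_isAveraging [NeZero n] (hW : IsMixingMatrix G W) :
    ∃ ρ, IsAveraging (mixLinear W : Stack n p →ₗ[ℝ] Stack n p) avgLinear ρ := by
  have hn : (n : ℝ) ≠ 0 := Nat.cast_ne_zero.2 (NeZero.ne n)
  refine ProxDGD.exists_isAveraging hW.inner_mix ?_ ?_ ?_ ?_ ?_ hW.inner_le hW.lamMin_gt
    hW.lamMin_mul_le_inner
  · intro x y
    rw [avgLinear_apply, avgLinear_apply, PiLp.inner_apply, PiLp.inner_apply]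
    simp only [avg, inner_smul_left, inner_smul_right,
      ← Finset.mul_sum, conj_trivial, ← sum_inner, ← inner_sum]
  · intro x
    ext i : 1
    simp only [avgLinear_apply, avg, Finset.sum_const, Finset.card_univ, Fintype.card_fin]
    rw [← Nat.cast_smul_eq_nsmul ℝ, inv_smul_smul₀ hn]
  · intro x
    ext i : 1
    simp only [avgLinear_apply, mixLinear_apply, mix, avg]
    rw [← Finset.sum_smul, hW.sum_row, one_smul]
  · intro x
    ext i : 1
    simp only [avgLinear_apply, mixLinear_apply, mix, avg]
    rw [Finset.sum_comm]
    simp only [← Finset.sum_smul, hW.sum_col, one_smul]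
  · intro x hx
    -- Each column of a fixed stack lies in the null space of `1 - W`, which is spanned by the
    -- constant vector.
    have hconst : ∀ c, ∃ a : ℝ, ∀ i, x i c = a := by
      intro c
      have h1 : column x c ∈ LinearMap.ker (Matrix.toLin' (1 - W)) := by
        rw [LinearMap.mem_ker, Matrix.toLin'_apply, Matrix.sub_mulVec, Matrix.one_mulVec,
          ← column_mix, ← mixLinear_apply, hx, sub_self]
      rw [hW.null_space, Submodule.mem_span_singleton] at h1
      obtain ⟨a, ha⟩ := h1
      refine ⟨a, fun i => ?_⟩
      have := congrFun ha i
      simpa [column] using this.symm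
    choose a ha using hconst
    ext i c
    simp only [avgLinear_apply, avg, PiLp.smul_apply, WithLp.ofLp_sum, Finset.sum_apply, ha,
      Finset.sum_const, Finset.card_univ, Fintype.card_fin, smul_eq_mul, nsmul_eq_mul]
    field_simp

end IsMixingMatrix

theorem mem_consensusSet_iff {G : SimpleGraph (Fin n)} (hG : G.Connected) {x : Stack n p} :
    x ∈ consensusSet G ↔ ∀ i j, x i = x j := by
  refine ⟨fun hx i j => ?_, fun hx i j _ => hx i j⟩
  obtain ⟨w⟩ := hG.preconnected i j
  induction w with
  | nil => rfl
  | cons h _ ih => exact (hx _ _ h).trans ih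

theorem mem_consensusSet_of_avg_eq {G : SimpleGraph (Fin n)} {x : Stack n p} (hx : avg x = x) :
    x ∈ consensusSet G := by
  intro i j _
  rw [← hx]
  rfl

theorem avg_eq_of_forall_eq [NeZero n] {x : Stack n p} (hx : ∀ i j, x i = x j) : avg x = x := by
  have hn : (n : ℝ) ≠ 0 := Nat.cast_ne_zero.2 (NeZero.ne n)
  ext i : 1
  simp only [avg]
  rw [Finset.sum_congr rfl fun j _ => hx j i, Finset.sum_const, Finset.card_univ,
    Fintype.card_fin, ← Nat.cast_smul_eq_nsmul ℝ, inv_smul_smul₀ hn]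

end Network

/-! ### The step sizes `1 / (L_f (k + 1)^ε)` -/

section StepSize

theorem stepSize_eq (Lf ε : ℝ) (k : ℕ) :
    stepSize Lf ε k = Lf⁻¹ * (((k : ℝ) + 1) ^ ε)⁻¹ := by
  rw [stepSize, one_div, mul_inv]

theorem stepSize_pos {Lf : ℝ} (hL : 0 < Lf) (ε : ℝ) (k : ℕ) : 0 < stepSize Lf ε k := by
  rw [stepSize]
  positivity

theorem isVanishingStep_stepSize {Lf ε : ℝ} (hL : 0 < Lf) (hε : 0 < ε) :
    IsVanishingStep (stepSize Lf ε) where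
  pos := stepSize_pos hL ε
  anti := by
    intro k m hkm
    rw [stepSize, stepSize]
    gcongr
  tendsto_zero := by
    have h1 : Tendsto (fun k : ℕ => ((k : ℝ) + 1) ^ ε) atTop atTop :=
      (tendsto_rpow_atTop hε).comp (tendsto_natCast_atTop_atTop.atTop_add tendsto_const_nhds)
    have h2 := (tendsto_inv_atTop_zero.comp h1).const_mul Lf⁻¹
    rw [mul_zero] at h2
    exact h2.congr fun k => (stepSize_eq Lf ε k).symm
  tendsto_ratio := by
    have h1 : Tendsto (fun k : ℕ => 1 + 1 / ((k : ℝ) + 1)) atTop (𝓝 1) := by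
      simpa using tendsto_one_div_add_atTop_nhds_zero_nat.const_add (1 : ℝ)
    have h2 := h1.rpow_const (p := ε) (Or.inr hε.le)
    rw [Real.one_rpow] at h2
    refine h2.congr fun k => ?_
    have h3 : (0 : ℝ) < (k : ℝ) + 1 := by positivity
    rw [stepSize, stepSize, show 1 + 1 / ((k : ℝ) + 1) = ((k : ℝ) + 1 + 1) / ((k : ℝ) + 1) by
      field_simp, Real.div_rpow (by positivity) h3.le]
    push_cast
    field_simp

theorem not_summable_stepSize {Lf ε : ℝ} (hL : 0 < Lf) (hε1 : ε ≤ 1) :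
    ¬ Summable (stepSize Lf ε) := by
  intro h
  have h1 : Summable fun k : ℕ => 1 / (((k + 1 : ℕ) : ℝ)) ^ ε := by
    refine (h.mul_left Lf).congr fun k => ?_
    rw [stepSize]
    push_cast
    field_simp
  rw [summable_nat_add_iff (f := fun k : ℕ => 1 / (k : ℝ) ^ ε) 1,
    Real.summable_one_div_nat_rpow] at h1
  linarith

theorem rpow_le_sum_inv_rpow {ε : ℝ} (hε : 0 ≤ ε) (K : ℕ) :
    ((K : ℝ) + 1) ^ (1 - ε) ≤ ∑ k ∈ Finset.range (K + 1), (((k : ℝ) + 1) ^ ε)⁻¹ := by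
  have h1 : ∀ k ∈ Finset.range (K + 1), (((K : ℝ) + 1) ^ ε)⁻¹ ≤ (((k : ℝ) + 1) ^ ε)⁻¹ := by
    intro k hk
    have : (k : ℝ) ≤ K := by
      exact_mod_cast Nat.lt_succ_iff.1 (Finset.mem_range.1 hk)
    gcongr
  have h2 := Finset.card_nsmul_le_sum _ _ _ h1
  rw [Finset.card_range, nsmul_eq_mul] at h2
  refine le_trans (le_of_eq ?_) h2
  rw [Real.rpow_sub (by positivity), Real.rpow_one, div_eq_mul_inv]
  push_cast
  rfl

/-- Bernoulli's inequality for exponents at most one bounds each term by `((m + 1) ^ s - m ^ s) /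
s`, and these bounds telescope. -/
theorem sum_inv_rpow_le {s : ℝ} (hs : 0 < s) (hs1 : s ≤ 1) (K : ℕ) :
    ∑ k ∈ Finset.range (K + 1), (((k : ℝ) + 1) ^ (1 - s))⁻¹ ≤ ((K : ℝ) + 1) ^ s / s := by
  have key : ∀ m : ℕ, ∑ k ∈ Finset.range m, (((k : ℝ) + 1) ^ (1 - s))⁻¹ ≤ (m : ℝ) ^ s / s := by
    intro m
    induction m with
    | zero => simp [Real.zero_rpow hs.ne']
    | succ m ih =>
      rw [Finset.sum_range_succ]
      push_cast
      have h0 : (0 : ℝ) < (m : ℝ) + 1 := by positivity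
      have h1 : (m : ℝ) ^ s ≤ ((m : ℝ) + 1) ^ s * (1 + s * (-(1 / ((m : ℝ) + 1)))) := by
        have h2 : (m : ℝ) = ((m : ℝ) + 1) * (1 + -(1 / ((m : ℝ) + 1))) := by
          field_simp
          ring
        have h3 : -1 ≤ -(1 / ((m : ℝ) + 1)) := by
          rw [neg_le_neg_iff, div_le_one h0]
          linarith [(Nat.cast_nonneg m : (0 : ℝ) ≤ m)]
        conv_lhs => rw [h2]
        rw [Real.mul_rpow h0.le (by linarith)]
        gcongr
        exact rpow_one_add_le_one_add_mul_self h3 hs.le hs1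
      have h4 : (((m : ℝ) + 1) ^ (1 - s))⁻¹ = ((m : ℝ) + 1) ^ s * (1 / ((m : ℝ) + 1)) := by
        rw [← Real.rpow_neg h0.le, neg_sub, Real.rpow_sub h0, Real.rpow_one]
        ring
      have h5 : (m : ℝ) ^ s / s ≤ ((m : ℝ) + 1) ^ s / s - (((m : ℝ) + 1) ^ (1 - s))⁻¹ := by
        rw [h4, div_le_iff₀ hs]
        refine h1.trans (le_of_eq ?_)
        field_simp
        ring
      linarith
  exact_mod_cast key (K + 1)

theorem log_le_sum_inv (K : ℕ) :
    Real.log ((K : ℝ) + 1) ≤ ∑ k ∈ Finset.range (K + 1), ((k : ℝ) + 1)⁻¹ := by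
  have h1 := log_add_one_le_harmonic (K + 1)
  have h2 : ((harmonic (K + 1) : ℚ) : ℝ) = ∑ k ∈ Finset.range (K + 1), ((k : ℝ) + 1)⁻¹ := by
    rw [harmonic]
    push_cast
    rfl
  rw [← h2]
  refine le_trans (Real.log_le_log (by positivity) ?_) h1
  push_cast
  linarith

theorem sum_inv_le_log (K : ℕ) :
    ∑ k ∈ Finset.range (K + 1), ((k : ℝ) + 1)⁻¹ ≤ 1 + Real.log ((K : ℝ) + 1) := by
  have h1 := harmonic_le_one_add_log (K + 1)
  have h2 : ((harmonic (K + 1) : ℚ) : ℝ) = ∑ k ∈ Finset.range (K + 1), ((k : ℝ) + 1)⁻¹ := by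
    rw [harmonic]
    push_cast
    rfl
  rw [← h2]
  exact_mod_cast h1

theorem sum_stepSize (Lf ε : ℝ) (K : ℕ) : ∑ k ∈ Finset.range (K + 1), stepSize Lf ε k
    = Lf⁻¹ * ∑ k ∈ Finset.range (K + 1), (((k : ℝ) + 1) ^ ε)⁻¹ := by
  simp only [stepSize_eq, Finset.mul_sum]

theorem sum_stepSize_sq (Lf ε : ℝ) (K : ℕ) : ∑ k ∈ Finset.range (K + 1), stepSize Lf ε k ^ 2
    = Lf⁻¹ ^ 2 * ∑ k ∈ Finset.range (K + 1), (((k : ℝ) + 1) ^ (2 * ε))⁻¹ := by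
  rw [Finset.mul_sum]
  refine Finset.sum_congr rfl fun k _ => ?_
  rw [stepSize_eq, mul_pow, inv_pow (_ ^ ε), mul_comm 2 ε, Real.rpow_mul (by positivity)]
  norm_cast

/-- A nonnegative sequence dominated by `c₁ / ∑ α_k + c₂ ∑ α_k² / ∑ α_k`, in terms of the
normalized sums. -/
theorem exists_bound_of_stepSize {Lf ε : ℝ} (hL : 0 < Lf) {D : ℕ → ℝ} {c₁ c₂ : ℝ} (hc₁ : 0 ≤ c₁)
    (hc₂ : 0 ≤ c₂)
    (hD : ∀ K, D K * ∑ k ∈ Finset.range (K + 1), stepSize Lf ε k ≤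
      c₁ + c₂ * ∑ k ∈ Finset.range (K + 1), stepSize Lf ε k ^ 2) :
    ∃ C, 0 ≤ C ∧ ∀ K, D K * ∑ k ∈ Finset.range (K + 1), (((k : ℝ) + 1) ^ ε)⁻¹ ≤
      C * (1 + ∑ k ∈ Finset.range (K + 1), (((k : ℝ) + 1) ^ (2 * ε))⁻¹) := by
  refine ⟨Lf * (c₁ + c₂ * Lf⁻¹ ^ 2), by positivity, fun K => ?_⟩
  have h1 := hD K
  rw [sum_stepSize, sum_stepSize_sq] at h1
  set A := ∑ k ∈ Finset.range (K + 1), (((k : ℝ) + 1) ^ ε)⁻¹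
  set Q := ∑ k ∈ Finset.range (K + 1), (((k : ℝ) + 1) ^ (2 * ε))⁻¹
  have hQ : 0 ≤ Q := Finset.sum_nonneg fun k _ => by positivity
  have h2 : D K * A = Lf * (D K * (Lf⁻¹ * A)) := by field_simp
  rw [h2, mul_assoc]
  refine mul_le_mul_of_nonneg_left (h1.trans ?_) hL.le
  have h3 : 0 ≤ c₁ * Q + c₂ * Lf⁻¹ ^ 2 := by positivity
  linarith

variable {ε C : ℝ} {D : ℕ → ℝ}

theorem isBigO_of_lt_half (hD0 : ∀ K, 0 ≤ D K) (hC : 0 ≤ C)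
    (hD : ∀ K, D K * ∑ k ∈ Finset.range (K + 1), (((k : ℝ) + 1) ^ ε)⁻¹ ≤
      C * (1 + ∑ k ∈ Finset.range (K + 1), (((k : ℝ) + 1) ^ (2 * ε))⁻¹))
    (hε : 0 < ε) (hε2 : ε < 1 / 2) : D =O[atTop] fun K : ℕ => 1 / (K : ℝ) ^ ε := by
  have hs : 0 < 1 - 2 * ε := by linarith
  refine IsBigO.of_bound (C * (1 + 1 / (1 - 2 * ε))) ?_
  filter_upwards [eventually_ge_atTop 1] with K hK
  have hK0 : (0 : ℝ) < K := by exact_mod_cast hK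
  have h1 := rpow_le_sum_inv_rpow hε.le K
  have h2 := sum_inv_rpow_le hs (by linarith) K
  rw [show 1 - (1 - 2 * ε) = 2 * ε by ring] at h2
  have h3 : 1 ≤ ((K : ℝ) + 1) ^ (1 - 2 * ε) := Real.one_le_rpow (by linarith) hs.le
  have h4 : D K * ((K : ℝ) + 1) ^ (1 - ε)
      ≤ C * ((1 + 1 / (1 - 2 * ε)) * ((K : ℝ) + 1) ^ (1 - 2 * ε)) := by
    refine (mul_le_mul_of_nonneg_left h1 (hD0 K)).trans ((hD K).trans ?_)
    gcongr
    rw [add_mul, one_mul, one_div, inv_mul_eq_div]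
    linarith
  -- The power `1 - 2 * ε` is the growth of the sum of squared steps. It cancels and leaves the rate
  -- `ε`.
  have h5 : ((K : ℝ) + 1) ^ (1 - ε) = ((K : ℝ) + 1) ^ (1 - 2 * ε) * ((K : ℝ) + 1) ^ ε := by
    rw [← Real.rpow_add (by positivity)]
    congr 1
    ring
  rw [h5, ← mul_assoc, mul_comm (D K), mul_assoc, ← mul_assoc C, mul_comm (C * _)] at h4
  have h6 := le_of_mul_le_mul_left h4 (by positivity)
  rw [Real.norm_of_nonneg (hD0 K), Real.norm_of_nonneg (by positivity), mul_one_div,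
    le_div_iff₀ (by positivity)]
  refine le_trans (mul_le_mul_of_nonneg_left ?_ (hD0 K)) h6
  gcongr
  linarith

theorem isBigO_of_eq_half (hD0 : ∀ K, 0 ≤ D K) (hC : 0 ≤ C)
    (hD : ∀ K, D K * ∑ k ∈ Finset.range (K + 1), (((k : ℝ) + 1) ^ ε)⁻¹ ≤
      C * (1 + ∑ k ∈ Finset.range (K + 1), (((k : ℝ) + 1) ^ (2 * ε))⁻¹))
    (hε : ε = 1 / 2) : D =O[atTop] fun K : ℕ => Real.log K / Real.sqrt K := by
  refine IsBigO.of_bound (C * 4) ?_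
  -- Since `3 > e`, `1 ≤ log K`; this absorbs the additive constants into `4 * log K`.
  filter_upwards [eventually_ge_atTop 3] with K hK
  have hK3 : (3 : ℝ) ≤ K := by exact_mod_cast hK
  have hK0 : (0 : ℝ) < K := by linarith
  have h1 := rpow_le_sum_inv_rpow (show 0 ≤ ε by rw [hε]; norm_num) K
  have h2 := sum_inv_le_log K
  have h3 := hD K
  simp only [hε, show (2 : ℝ) * (1 / 2) = 1 by norm_num, Real.rpow_one] at h1 h3
  rw [show (1 : ℝ) - 1 / 2 = 1 / 2 by norm_num, ← Real.sqrt_eq_rpow] at h1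
  have hlog : 1 ≤ Real.log K := by
    rw [Real.le_log_iff_exp_le hK0]
    exact Real.exp_one_lt_three.le.trans hK3
  have hlog2 : Real.log ((K : ℝ) + 1) ≤ 2 * Real.log K := by
    rw [show 2 * Real.log (K : ℝ) = Real.log ((K : ℝ) ^ 2) by rw [Real.log_pow]; norm_num]
    apply Real.log_le_log (by positivity)
    nlinarith
  have h4 : D K * Real.sqrt K ≤ C * (4 * Real.log K) := by
    calc D K * Real.sqrt K ≤ D K * Real.sqrt ((K : ℝ) + 1) := by
          have := hD0 K
          gcongr
          linarith
      _ ≤ _ := mul_le_mul_of_nonneg_left h1 (hD0 K)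
      _ ≤ _ := h3
      _ ≤ _ := by gcongr; linarith
  rw [Real.norm_of_nonneg (hD0 K), Real.norm_of_nonneg (by positivity), ← mul_div_assoc,
    le_div_iff₀ (by positivity)]
  linarith

theorem sum_inv_rpow_bounded {q : ℝ} (hq : 1 < q) :
    ∃ Q, ∀ K : ℕ, ∑ k ∈ Finset.range (K + 1), (((k : ℝ) + 1) ^ q)⁻¹ ≤ Q := by
  have h1 := (summable_nat_add_iff 1).2 (Real.summable_nat_rpow_inv.2 hq)
  refine ⟨∑' k : ℕ, (((k + 1 : ℕ) : ℝ) ^ q)⁻¹, fun K => ?_⟩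
  have := h1.sum_le_tsum (Finset.range (K + 1)) (fun k _ => by positivity)
  simpa only [Nat.cast_add, Nat.cast_one] using this

theorem isBigO_of_gt_half (hD0 : ∀ K, 0 ≤ D K) (hC : 0 ≤ C)
    (hD : ∀ K, D K * ∑ k ∈ Finset.range (K + 1), (((k : ℝ) + 1) ^ ε)⁻¹ ≤
      C * (1 + ∑ k ∈ Finset.range (K + 1), (((k : ℝ) + 1) ^ (2 * ε))⁻¹))
    (hε : 1 / 2 < ε) (hε1 : ε < 1) :
    D =O[atTop] fun K : ℕ => 1 / (K : ℝ) ^ (1 - ε) := by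
  obtain ⟨Q, hQ⟩ := sum_inv_rpow_bounded (show 1 < 2 * ε by linarith)
  refine IsBigO.of_bound (C * (1 + Q)) ?_
  filter_upwards [eventually_ge_atTop 1] with K hK
  have hK0 : (0 : ℝ) < K := by exact_mod_cast hK
  have h1 := rpow_le_sum_inv_rpow (show 0 ≤ ε by linarith) K
  rw [Real.norm_of_nonneg (hD0 K), Real.norm_of_nonneg (by positivity), mul_one_div,
    le_div_iff₀ (by positivity)]
  calc D K * (K : ℝ) ^ (1 - ε) ≤ D K * ((K : ℝ) + 1) ^ (1 - ε) := by
        have := hD0 K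
        gcongr
        linarith
    _ ≤ _ := mul_le_mul_of_nonneg_left h1 (hD0 K)
    _ ≤ _ := hD K
    _ ≤ _ := by gcongr; exact hQ K

theorem isBigO_of_eq_one (hD0 : ∀ K, 0 ≤ D K) (hC : 0 ≤ C)
    (hD : ∀ K, D K * ∑ k ∈ Finset.range (K + 1), (((k : ℝ) + 1) ^ ε)⁻¹ ≤
      C * (1 + ∑ k ∈ Finset.range (K + 1), (((k : ℝ) + 1) ^ (2 * ε))⁻¹))
    (hε : ε = 1) : D =O[atTop] fun K : ℕ => 1 / Real.log K := by
  obtain ⟨Q, hQ⟩ := sum_inv_rpow_bounded (show 1 < 2 * ε by linarith)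
  refine IsBigO.of_bound (C * (1 + Q)) ?_
  filter_upwards [eventually_ge_atTop 2] with K hK
  have hK2 : (2 : ℝ) ≤ K := by exact_mod_cast hK
  have hlog : 0 < Real.log K := Real.log_pos (by linarith)
  have h1 := log_le_sum_inv K
  have h2 := hD K
  have h3 := hQ K
  simp only [hε, Real.rpow_one] at h2 h3
  rw [Real.norm_of_nonneg (hD0 K), Real.norm_of_nonneg (by positivity), mul_one_div,
    le_div_iff₀ hlog]
  calc D K * Real.log K ≤ D K * Real.log ((K : ℝ) + 1) := by
        have := hD0 K
        gcongr
        linarith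
    _ ≤ _ := mul_le_mul_of_nonneg_left h1 (hD0 K)
    _ ≤ _ := h2
    _ ≤ _ := by gcongr

theorem tendsto_zero_of_rates (hε : 0 < ε) (hε1 : ε ≤ 1)
    (h₁ : ε < 1 / 2 → D =O[atTop] fun K : ℕ => 1 / (K : ℝ) ^ ε)
    (h₂ : ε = 1 / 2 → D =O[atTop] fun K : ℕ => Real.log K / Real.sqrt K)
    (h₃ : 1 / 2 < ε → ε < 1 → D =O[atTop] fun K : ℕ => 1 / (K : ℝ) ^ (1 - ε))
    (h₄ : ε = 1 → D =O[atTop] fun K : ℕ => 1 / Real.log K) : Tendsto D atTop (𝓝 0) := by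
  have hpow : ∀ s : ℝ, 0 < s → Tendsto (fun K : ℕ => 1 / (K : ℝ) ^ s) atTop (𝓝 0) := by
    intro s hs
    simp only [one_div]
    exact tendsto_inv_atTop_zero.comp ((tendsto_rpow_atTop hs).comp tendsto_natCast_atTop_atTop)
  rcases lt_trichotomy ε (1 / 2) with h | h | h
  · exact (h₁ h).trans_tendsto (hpow ε hε)
  · refine (h₂ h).trans_tendsto ?_
    have h5 := (isLittleO_log_rpow_atTop (show (0 : ℝ) < 1 / 2 by norm_num)).tendsto_div_nhds_zero
    refine (h5.comp tendsto_natCast_atTop_atTop).congr fun K => ?_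
    simp [Real.sqrt_eq_rpow]
  · rcases hε1.lt_or_eq with h' | h'
    · exact (h₃ h h').trans_tendsto (hpow _ (by linarith))
    · refine (h₄ h').trans_tendsto ?_
      simp only [one_div]
      exact tendsto_inv_atTop_zero.comp (Real.tendsto_log_atTop.comp tendsto_natCast_atTop_atTop)

end StepSize

/-! ### Stacked functions -/

section Stacked

variable {n p : ℕ}

theorem coe_sum_ereal {ι : Type*} (s : Finset ι) (g : ι → ℝ) :
    ((∑ i ∈ s, g i : ℝ) : EReal) = ∑ i ∈ s, (g i : EReal) := by
  classical
  induction s using Finset.induction_on with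
  | empty => simp
  | insert a s ha ih => rw [Finset.sum_insert ha, Finset.sum_insert ha, EReal.coe_add, ih]

theorem rSum_coe (ρ : Fin n → Vec p → ℝ) :
    rSum (fun i u => (ρ i u : EReal)) = fun x => ((smoothSum ρ x : ℝ) : EReal) := by
  funext x
  rw [rSum, smoothSum, coe_sum_ereal]

theorem objective_coe (f ρ : Fin n → Vec p → ℝ) (x : Stack n p) :
    objective f (fun i u => (ρ i u : EReal)) x = ((smoothSum f x + smoothSum ρ x : ℝ) : EReal) := by
  rw [objective, smoothSum, smoothSum, ← Finset.sum_add_distrib, coe_sum_ereal]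
  simp only [EReal.coe_add]

theorem lyapunov_coe (W : Matrix (Fin n) (Fin n) ℝ) (f ρ : Fin n → Vec p → ℝ) (a : ℝ)
    (x : Stack n p) : lyapunov W f (fun i u => (ρ i u : EReal)) a x =
      ((smoothSum f x + smoothSum ρ x + inner ℝ x (x - mixLinear W x) / (2 * a) : ℝ) : EReal) := by
  rw [lyapunov, rSum_coe, ← EReal.coe_add, seminormSq, mixLinear_apply]
  congr 1
  ring

theorem sum_norm_row_le (c : Fin n → ℝ) (hc : ∀ i, 0 ≤ c i) (x : Stack n p) :
    ∑ i, c i * ‖x i‖ ≤ (∑ i, c i) * ‖x‖ := by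
  rw [Finset.sum_mul]
  refine Finset.sum_le_sum fun i _ => ?_
  have := hc i
  gcongr
  exact PiLp.norm_apply_le x i

theorem exists_lipschitz_smoothSum {h : Fin n → Vec p → ℝ}
    (hh : ∀ i, ∃ M : ℝ, 0 ≤ M ∧ ∀ u v, |h i u - h i v| ≤ M * ‖u - v‖) :
    ∃ M : ℝ, 0 ≤ M ∧ ∀ x y : Stack n p, |smoothSum h x - smoothSum h y| ≤ M * ‖x - y‖ := by
  choose M hM0 hM using hh
  refine ⟨∑ i, M i, Finset.sum_nonneg fun i _ => hM0 i, fun x y => ?_⟩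
  rw [smoothSum, smoothSum, ← Finset.sum_sub_distrib]
  refine (Finset.abs_sum_le_sum_abs _ _).trans (le_trans ?_ (sum_norm_row_le M hM0 (x - y)))
  exact Finset.sum_le_sum fun i _ => hM i _ _

theorem exists_norm_gradStack_le {f : Fin n → Vec p → ℝ}
    (hB : ∀ i, ∃ B : ℝ, ∀ u, ‖gradient (f i) u‖ ≤ B) :
    ∃ B : ℝ, 0 ≤ B ∧ ∀ x : Stack n p, ‖gradStack f x‖ ≤ B := by
  choose B hB using hB
  refine ⟨Real.sqrt (∑ i, B i ^ 2), Real.sqrt_nonneg _, fun x => Real.le_sqrt_of_sq_le ?_⟩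
  rw [PiLp.norm_sq_eq_of_L2]
  refine Finset.sum_le_sum fun i _ => ?_
  have := hB i (x i)
  simp only [gradStack]
  gcongr

theorem norm_gradStack_sub_le {f : Fin n → Vec p → ℝ} {L : Fin n → ℝ} {Lf : ℝ}
    (hf : ∀ i, IsLipschitzDifferentiable (f i) (L i)) (hL : ∀ i, L i ≤ Lf) (hLf : 0 ≤ Lf)
    (x y : Stack n p) : ‖gradStack f x - gradStack f y‖ ≤ Lf * ‖x - y‖ := by
  refine abs_le_of_sq_le_sq' ?_ (by positivity) |>.2
  rw [mul_pow, PiLp.norm_sq_eq_of_L2, PiLp.norm_sq_eq_of_L2, Finset.mul_sum]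
  refine Finset.sum_le_sum fun i _ => ?_
  rw [← mul_pow]
  refine pow_le_pow_left₀ (norm_nonneg _) (((hf i).2.2 _ _).trans ?_) 2
  exact mul_le_mul_of_nonneg_right (hL i) (norm_nonneg _)

theorem smoothSum_le_quadratic {f : Fin n → Vec p → ℝ} {L : Fin n → ℝ} {Lf : ℝ}
    (hf : ∀ i, IsLipschitzDifferentiable (f i) (L i)) (hL : ∀ i, L i ≤ Lf) (x y : Stack n p) :
    smoothSum f y ≤ smoothSum f x + inner ℝ (gradStack f x) (y - x) + Lf / 2 * ‖y - x‖ ^ 2 := by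
  rw [PiLp.inner_apply, PiLp.norm_sq_eq_of_L2, Finset.mul_sum, smoothSum, smoothSum,
    ← Finset.sum_add_distrib, ← Finset.sum_add_distrib]
  refine Finset.sum_le_sum fun i _ => ?_
  refine (le_quadratic_of_lipschitz_gradient (fun u => ((hf i).2.1 u).hasGradientAt)
    (hf i).2.2 (x i) (y i)).trans ?_
  have := hL i
  simp only [gradStack, PiLp.sub_apply]
  gcongr

/-- The quadratic lower bound makes each gradient a proximal subgradient, and convexity removes the
quadratic error. -/
theorem smoothSum_gradient_le {f : Fin n → Vec p → ℝ} {L : Fin n → ℝ}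
    (hf : ∀ i, IsLipschitzDifferentiable (f i) (L i)) (hc : ∀ i, ConvexOn ℝ Set.univ (f i))
    (x y : Stack n p) : smoothSum f x + inner ℝ (gradStack f x) (y - x) ≤ smoothSum f y := by
  rw [PiLp.inner_apply, smoothSum, smoothSum, ← Finset.sum_add_distrib]
  refine Finset.sum_le_sum fun i _ => ?_
  exact subgradient_of_convexOn (hc i) (fun u => quadratic_le_of_lipschitz_gradient
    (fun u => ((hf i).2.1 u).hasGradientAt) (hf i).2.2 (x i) u) (y i)

theorem convexOn_smoothSum {h : Fin n → Vec p → ℝ} (hc : ∀ i, ConvexOn ℝ Set.univ (h i)) :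
    ConvexOn ℝ Set.univ (smoothSum h : Stack n p → ℝ) := by
  refine ⟨convex_univ, fun x _ y _ a b ha hb hab => ?_⟩
  simp only [smoothSum, smul_eq_mul, Finset.mul_sum, ← Finset.sum_add_distrib]
  exact Finset.sum_le_sum fun i _ => (hc i).2 (Set.mem_univ (x i)) (Set.mem_univ (y i)) ha hb hab

theorem tendsto_cobounded_of_isCoercive {E : Type*} [NormedAddCommGroup E] [InnerProductSpace ℝ E]
    {h : E → ℝ} (hc : IsCoercive fun u => (h u : EReal)) :
    Tendsto h (Bornology.cobounded E) atTop := by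
  rw [← comap_norm_atTop]
  exact EReal.tendsto_coe_nhds_top_iff.1 hc

theorem exists_forall_le_of_isCoercive {h : Vec p → ℝ} (hc : IsCoercive fun u => (h u : EReal))
    (hcont : Continuous h) : ∃ u, ∀ v, h u ≤ h v := by
  refine hcont.exists_forall_le ?_
  rw [← Metric.cobounded_eq_cocompact]
  exact tendsto_cobounded_of_isCoercive hc

/-- One coercive summand makes the sum coercive, because the others are bounded below by their
minima. -/
theorem exists_sum_forall_le [NeZero n] {h : Fin n → Vec p → ℝ}
    (hc : ∀ i, IsCoercive fun u => (h i u : EReal)) (hcont : ∀ i, Continuous (h i)) :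
    ∃ u, ∀ v, ∑ i, h i u ≤ ∑ i, h i v := by
  have hb := fun i => exists_forall_le_of_isCoercive (hc i) (hcont i)
  choose m hm using hb
  refine (continuous_finsetSum _ fun i _ => hcont i).exists_forall_le ?_
  rw [← Metric.cobounded_eq_cocompact]
  refine tendsto_atTop_mono (fun v => ?_) (tendsto_atTop_add_const_right _
    (∑ i ∈ Finset.univ.erase (0 : Fin n), h i (m i)) (tendsto_cobounded_of_isCoercive (hc 0)))
  rw [← Finset.add_sum_erase _ _ (Finset.mem_univ (0 : Fin n))]
  gcongr with i _
  exact hm i v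

/-- All rows of an average coincide, so one of them suffices to turn `P w → 0` into the vanishing of
the row sum. -/
theorem sum_row_eq [NeZero n] (w : Stack n p) : ∑ i, w i = (n : ℝ) • avgLinear w 0 := by
  have hn : (n : ℝ) ≠ 0 := Nat.cast_ne_zero.2 (NeZero.ne n)
  rw [avgLinear_apply, avg, smul_inv_smul₀ hn]

end Stacked

/-! ### Convergence of Prox-DGD -/

section Convergence

variable {n p : ℕ} {G : SimpleGraph (Fin n)}

/-- Limit points are stationary when the averaged subgradients tend to zero. -/
theorem isStationary_of_mapClusterPt [NeZero n] {f ρ : Fin n → Vec p → ℝ} {T : Stack n p →ₗ[ℝ] Stack n p}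
    {σ : ℝ} (hT : IsAveraging T avgLinear σ) {α : ℕ → ℝ} (hα : IsVanishingStep α)
    {x ξ : ℕ → Stack n p}
    (hx : ∀ k, x (k + 1) = T (x k) - α k • (gradStack f (x k) + ξ (k + 1)))
    {D B : ℝ} (hv : ∀ k, ‖gradStack f (x k) + ξ (k + 1)‖ ≤ D) (hξ : ∀ k, ‖ξ (k + 1)‖ ≤ B)
    (hgrad : Continuous (gradStack f : Stack n p → Stack n p))
    (hρ : Continuous (smoothSum ρ : Stack n p → ℝ))
    (hsub : ∀ k, ξ (k + 1) ∈ frechetSubdiff (rSum fun i u => (ρ i u : EReal)) (x (k + 1)))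
    (hlim : Tendsto (fun k => ∑ i, (gradStack f (x k) i + ξ (k + 1) i)) atTop (𝓝 0))
    {y : Stack n p} (hy : MapClusterPt y atTop x) :
    IsStationary G f (fun i u => (ρ i u : EReal)) y := by
  obtain ⟨C, -, hdis⟩ := hT.exists_disagreement_le hα hx hv
  obtain ⟨C', -, hinc⟩ := hT.exists_increment_le hα hx hv
  obtain ⟨ψ, hψ, hxψ⟩ := hy.tendsto_subseq
  have hzero : ∀ c : ℝ, Tendsto (fun k => c * α k) atTop (𝓝 0) := fun c => by
    simpa using hα.tendsto_zero.const_mul c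
  have hdis0 : Tendsto (fun k => x k - avgLinear (x k)) atTop (𝓝 0) :=
    squeeze_zero_norm hdis (hzero C)
  have hinc0 : Tendsto (fun k => x (k + 1) - x k) atTop (𝓝 0) :=
    squeeze_zero_norm hinc (hzero C')
  have havg : avg y = y := by
    have h1 : Tendsto (fun j => x (ψ j) - avgLinear (x (ψ j))) atTop (𝓝 (y - avgLinear y)) :=
      hxψ.sub ((hT.continuous_proj.tendsto y).comp hxψ)
    have h2 := tendsto_nhds_unique h1 (hdis0.comp hψ.tendsto_atTop)
    exact (sub_eq_zero.1 h2).symm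
  refine ⟨mem_consensusSet_of_avg_eq havg, ?_⟩
  -- Boundedness of the prox-subgradients permits a second extraction. They belong to `x (k + 1)`
  -- rather than `x k`, which is harmless since the increments vanish.
  obtain ⟨ξ', -, φ, hφ, hξφ⟩ := tendsto_subseq_of_bounded
    (Metric.isBounded_closedBall (x := (0 : Stack n p)) (r := B))
    (x := fun j => ξ (ψ j + 1)) (fun j => by simpa using hξ (ψ j))
  have hk : Tendsto (fun j => ψ (φ j)) atTop atTop := hψ.tendsto_atTop.comp hφ.tendsto_atTop
  have hx1 : Tendsto (fun j => x (ψ (φ j))) atTop (𝓝 y) := hxψ.comp hφ.tendsto_atTop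
  have hx2 : Tendsto (fun j => x (ψ (φ j) + 1)) atTop (𝓝 y) := by
    simpa using (hinc0.comp hk).add hx1
  refine ⟨ξ', ⟨?_, ?_, fun j => x (ψ (φ j) + 1), fun j => ξ (ψ (φ j) + 1), hx2, ?_,
    fun j => hsub _, hξφ⟩, ?_⟩
  · rw [rSum_coe]
    exact EReal.coe_ne_top _
  · rw [rSum_coe]
    exact EReal.coe_ne_bot _
  · rw [rSum_coe]
    exact (continuous_coe_real_ereal.tendsto _).comp ((hρ.tendsto y).comp hx2)
  · have h1 : Tendsto (fun j => gradStack f (x (ψ (φ j))) + ξ (ψ (φ j) + 1)) atTop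
        (𝓝 (gradStack f y + ξ')) := ((hgrad.tendsto y).comp hx1).add hξφ
    have h2 : Continuous fun w : Stack n p => ∑ i, w i :=
      continuous_finsetSum _ fun i _ => by fun_prop
    exact tendsto_nhds_unique ((h2.tendsto _).comp h1) (hlim.comp hk)

/-- The ergodic objective as a real number. -/
theorem ergodicObjective_coe (f ρ : Fin n → Vec p → ℝ) (α : ℕ → ℝ) (x : ℕ → Stack n p) (K : ℕ) :
    ergodicObjective f (fun i u => (ρ i u : EReal)) α x K =
      (((∑ k ∈ Finset.range (K + 1), α k * (smoothSum f (avg (x (k + 1)))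
        + smoothSum ρ (avg (x (k + 1))))) / ∑ k ∈ Finset.range (K + 1), α k : ℝ) : EReal) := by
  rw [ergodicObjective, EReal.coe_div]
  simp only [objective_coe, ← EReal.coe_mul, ← coe_sum_ereal]

end Convergence

end ProxDGD

end

/-! ### Proof of the theorem -/

theorem theorem4 {n p : ℕ}
    -- the connected network and the mixing matrix
    (G : SimpleGraph (Fin n)) (hG : G.Connected)
    (W : Matrix (Fin n) (Fin n) ℝ) (hW : ProxDGD.IsMixingMatrix G W)
    -- the composite objective
    (f : Fin n → ProxDGD.Vec p → ℝ) (r : Fin n → ProxDGD.Vec p → EReal) (L : Fin n → ℝ)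
    (hf : ∀ i, ProxDGD.IsLipschitzDifferentiable (f i) (L i))
    (hproper : ∀ i, ProxDGD.IsProper (fun u => (f i u : EReal) + r i u))
    (hlsc : ∀ i, LowerSemicontinuous (fun u => (f i u : EReal) + r i u))
    (hcoer : ∀ i, ProxDGD.IsCoercive (fun u => (f i u : EReal) + r i u))
    -- bounded gradients and subgradients
    (hBf : ∀ i, ∃ B : ℝ, ∀ u, ‖gradient (f i) u‖ ≤ B)
    (hBr : ∀ i, ∃ B : ℝ, ∀ u, ∀ v ∈ ProxDGD.subdiff (r i) u, ‖v‖ ≤ B)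
    -- the step sizes
    (Lf : ℝ) (hLf : Lf = ProxDGD.maxConst L)
    (ε : ℝ) (hε : 0 < ε) (hε1 : ε ≤ 1)
    (α : ℕ → ℝ) (hα : α = ProxDGD.stepSize Lf ε)
    -- the iterates and the prox-subgradients
    (x ξ : ℕ → ProxDGD.Stack n p) (hx : ProxDGD.IsProxDGD W f r α x)
    (hξ : ProxDGD.IsProxSubgradSeq W f α x ξ) :
    -- (a)
    (((∀ i, ProxDGD.IsConvexFun (r i)) ∨ 0 < ProxDGD.lamMin W) →
      ∃ l : ℝ,
        Tendsto (fun k => ProxDGD.lyapunov W f r (α k) (x k)) atTop (𝓝 (l : EReal)) ∧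
        Tendsto (fun k => ProxDGD.objective f r (x k)) atTop (𝓝 (l : EReal))) ∧
    -- (b)
    ((∀ i, ProxDGD.IsConvexFun (r i)) →
      Summable (fun k =>
        ((α k)⁻¹ * (1 + ProxDGD.lamMin W) - Lf) * ‖x (k + 1) - x k‖ ^ 2)) ∧
    (0 < ProxDGD.lamMin W →
      Summable (fun k =>
        ((α k)⁻¹ * ProxDGD.lamMin W - Lf) * ‖x (k + 1) - x k‖ ^ 2)) ∧
    -- (c)
    (∀ k, ξ (k + 1) ∈ ProxDGD.subdiff (ProxDGD.rSum r) (x (k + 1))) ∧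
    ((∃ Lr : ℝ, 0 < Lr ∧ ∃ k₀ : ℕ, 0 < k₀ ∧
        ∀ k, k₀ < k → ‖ξ (k + 1) - ξ k‖ ≤ Lr * ‖x (k + 1) - x k‖) →
      Tendsto (fun k => ∑ i, (ProxDGD.gradStack f (x k) i + ξ (k + 1) i)) atTop (𝓝 0) ∧
      ∀ y, MapClusterPt y atTop x → ProxDGD.IsStationary G f r y) ∧
    -- (d)
    (∀ y, MapClusterPt y atTop x →
      (∃ U ∈ 𝓝 y, ∀ z ∈ U, MapClusterPt z atTop x → z = y) →
      Tendsto x atTop (𝓝 y)) ∧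
    -- (e)
    ((∀ i, ConvexOn ℝ Set.univ (f i)) → (∀ i, ProxDGD.IsConvexFun (r i)) →
      0 < ProxDGD.lamMin W →
      ∃ (sopt : ℝ) (sbar : ℕ → ℝ),
        IsLeast (ProxDGD.objective f r '' ProxDGD.consensusSet G) (sopt : EReal) ∧
        (∀ K, ProxDGD.ergodicObjective f r α x K = (sbar K : EReal)) ∧
        Tendsto sbar atTop (𝓝 sopt) ∧
        (ε < 1 / 2 →
          (fun K => sbar K - sopt) =O[atTop] fun K : ℕ => 1 / (K : ℝ) ^ ε) ∧
        (ε = 1 / 2 →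
          (fun K => sbar K - sopt) =O[atTop] fun K : ℕ => Real.log K / Real.sqrt K) ∧
        (1 / 2 < ε → ε < 1 →
          (fun K => sbar K - sopt) =O[atTop] fun K : ℕ => 1 / (K : ℝ) ^ (1 - ε)) ∧
        (ε = 1 →
          (fun K => sbar K - sopt) =O[atTop] fun K : ℕ => 1 / Real.log K)) := by
  have hne : NeZero n := by
    obtain ⟨i⟩ := hG.nonempty
    exact ⟨fun h => by subst h; exact i.elim0⟩
  -- reduction to finite Lipschitz functions
  have hfin : ∀ i, ∃ (ρ : ProxDGD.Vec p → ℝ) (M : ℝ), 0 ≤ M ∧ (∀ u, r i u = (ρ u : EReal)) ∧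
      ∀ u v, |ρ u - ρ v| ≤ M * ‖u - v‖ := by
    intro i
    obtain ⟨B, hB⟩ := hBf i
    obtain ⟨B', hB'⟩ := hBr i
    exact ProxDGD.exists_lipschitz_of_subdiff_bounded (hf i).2.1 (hproper i) (hlsc i) (hcoer i)
      hB hB'
  choose ρ Mρ hMρ hrρ hρlip using hfin
  obtain rfl : r = fun i u => (ρ i u : EReal) := by
    funext i u
    exact hrρ i u
  have hLle : ∀ i, L i ≤ Lf := by
    intro i
    rw [hLf]
    exact le_ciSup (Set.finite_range L).bddAbove i
  have hLf0 : 0 < Lf := (hf 0).1.trans_le (hLle 0)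
  have hstep : ProxDGD.IsVanishingStep α := by
    rw [hα]
    exact ProxDGD.isVanishingStep_stepSize hLf0 hε
  have hdiv : ¬ Summable α := by
    rw [hα]
    exact ProxDGD.not_summable_stepSize hLf0 hε1
  obtain ⟨σ, hT⟩ := hW.exists_isAveraging (p := p)
  -- regularity of the stacked functions
  obtain ⟨MR, hMR, hRlip⟩ := ProxDGD.exists_lipschitz_smoothSum (n := n) (h := ρ)
    fun i => ⟨Mρ i, hMρ i, hρlip i⟩
  obtain ⟨MF, hMF, hFlip⟩ := ProxDGD.exists_lipschitz_smoothSum (n := n) (h := f) fun i => by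
    obtain ⟨B, hB⟩ := hBf i
    exact ⟨B, (norm_nonneg _).trans (hB 0), ProxDGD.abs_sub_le_of_gradient_le (hf i).2.1 hB⟩
  obtain ⟨Bg, hBg, hg⟩ := ProxDGD.exists_norm_gradStack_le (n := n) (p := p) hBf
  have hcont : ∀ i, Continuous fun u => f i u + ρ i u := by
    intro i
    refine (hf i).2.1.continuous.add ?_
    exact (LipschitzWith.of_dist_le_mul (K := ⟨Mρ i, hMρ i⟩) fun u v => by
      rw [Real.dist_eq, dist_eq_norm]
      exact hρlip i u v).continuous
  have hcoer' : ∀ i, ProxDGD.IsCoercive fun u => ((f i u + ρ i u : ℝ) : EReal) := hcoer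
  have hbelow : ∃ b, ∀ y : ProxDGD.Stack n p, b ≤ ProxDGD.smoothSum f y + ProxDGD.smoothSum ρ y := by
    have h1 := fun i => ProxDGD.exists_forall_le_of_isCoercive (hcoer' i) (hcont i)
    choose m hm using h1
    refine ⟨∑ i, (f i (m i) + ρ i (m i)), fun y => ?_⟩
    rw [ProxDGD.smoothSum, ProxDGD.smoothSum, ← Finset.sum_add_distrib]
    exact Finset.sum_le_sum fun i _ => hm i (y i)
  obtain ⟨b, hb⟩ := hbelow
  -- the iteration
  have hit : ∀ k, x (k + 1) = ProxDGD.mixLinear W (x k)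
      - α k • (ProxDGD.gradStack f (x k) + ξ (k + 1)) := by
    intro k
    have h1 := eq_sub_of_add_eq (hξ k)
    rw [h1, ProxDGD.mixLinear_apply, smul_add]
    abel
  have hprox : ∀ k u, ProxDGD.smoothSum ρ (x (k + 1)) + inner ℝ (ξ (k + 1)) (u - x (k + 1))
      - 1 / (2 * α k) * ‖u - x (k + 1)‖ ^ 2 ≤ ProxDGD.smoothSum ρ u := by
    intro k u
    have h1 := hx k
    rw [ProxDGD.rSum_coe] at h1
    exact ProxDGD.proximal_subgradient_of_mem_prox (hstep.pos k) h1 (hξ k) u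
  have hξB : ∀ k, ‖ξ (k + 1)‖ ≤ MR := fun k =>
    ProxDGD.norm_le_of_proximal_subgradient hMR hRlip (hprox k)
  have hv : ∀ k, ‖ProxDGD.gradStack f (x k) + ξ (k + 1)‖ ≤ Bg + MR := fun k =>
    (norm_add_le _ _).trans (add_le_add (hg _) (hξB k))
  have hFq : ∀ k, ProxDGD.smoothSum f (x (k + 1)) ≤ ProxDGD.smoothSum f (x k)
      + inner ℝ (ProxDGD.gradStack f (x k)) (x (k + 1) - x k)
      + Lf / 2 * ‖x (k + 1) - x k‖ ^ 2 := fun k =>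
    ProxDGD.smoothSum_le_quadratic hf hLle _ _
  have hflip : ∀ k, inner ℝ (ξ (k + 1)) (x k - x (k + 1))
      = - inner ℝ (ξ (k + 1)) (x (k + 1) - x k) := fun k => by
    rw [← inner_neg_right, neg_sub]
  have hR1 : ∀ k, ProxDGD.smoothSum ρ (x (k + 1)) ≤ ProxDGD.smoothSum ρ (x k)
      + inner ℝ (ξ (k + 1)) (x (k + 1) - x k) + 1 / (2 * α k) * ‖x (k + 1) - x k‖ ^ 2 := by
    intro k
    have h1 := hprox k (x k)
    rw [hflip, norm_sub_rev] at h1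
    linarith
  have hRc : (∀ i, ProxDGD.IsConvexFun fun u => (ρ i u : EReal)) → ∀ k u,
      ProxDGD.smoothSum ρ (x (k + 1)) + inner ℝ (ξ (k + 1)) (u - x (k + 1))
        ≤ ProxDGD.smoothSum ρ u := fun hc k u =>
    ProxDGD.subgradient_of_convexOn (ProxDGD.convexOn_smoothSum fun i =>
      ProxDGD.convexOn_of_isConvexFun (hc i)) (hprox k) u
  have hR0 : (∀ i, ProxDGD.IsConvexFun fun u => (ρ i u : EReal)) → ∀ k,
      ProxDGD.smoothSum ρ (x (k + 1)) ≤ ProxDGD.smoothSum ρ (x k)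
      + inner ℝ (ξ (k + 1)) (x (k + 1) - x k) + 0 / (2 * α k) * ‖x (k + 1) - x k‖ ^ 2 := by
    intro hc k
    have h1 := hRc hc k (x k)
    rw [hflip] at h1
    rw [zero_div, zero_mul]
    linarith
  have hlam := hW.lamMin_mul_le_inner (p := p)
  have hsub : ∀ k, ξ (k + 1) ∈ ProxDGD.frechetSubdiff
      (ProxDGD.rSum fun i u => (ρ i u : EReal)) (x (k + 1)) := by
    intro k
    rw [ProxDGD.rSum_coe]
    refine ProxDGD.mem_frechetSubdiff_of_proximal (c := 1 / (2 * α k)) (EReal.coe_ne_top _)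
      (EReal.coe_ne_bot _) fun u => ?_
    have := hprox k u
    rw [← EReal.coe_add, EReal.coe_le_coe_iff]
    linarith
  -- The convex case takes `θ = 0`, the other `θ = 1`. The requirement `0 < 1 + lam - θ` then reads
  -- `-1 < lamMin W`, respectively `0 < lamMin W`.
  have hconv := fun hc : ∀ i, ProxDGD.IsConvexFun fun u => (ρ i u : EReal) =>
    hT.lyapunov_convergence hstep hit hv hFq (hR0 hc) hlam
      (by linarith [hW.lamMin_gt]) hb
  have hpos := fun hl : 0 < ProxDGD.lamMin W =>
    hT.lyapunov_convergence hstep hit hv hFq hR1 hlam (by linarith) hb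
  refine ⟨fun h => ?_, fun hc => ?_, fun hl => ?_, fun k => ?_, ?_, fun y hy hiso => ?_,
    fun hfc hrc _ => ?_⟩
  · obtain ⟨l, h1, h2⟩ : ∃ l, Tendsto (fun k => ProxDGD.smoothSum f (x k)
        + ProxDGD.smoothSum ρ (x k)
        + inner ℝ (x k) (x k - ProxDGD.mixLinear W (x k)) / (2 * α k)) atTop (𝓝 l) ∧
        Tendsto (fun k => ProxDGD.smoothSum f (x k) + ProxDGD.smoothSum ρ (x k)) atTop (𝓝 l) := by
      rcases h with h | h
      · exact (hconv h).1
      · exact (hpos h).1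
    refine ⟨l, ?_, ?_⟩
    · simp only [ProxDGD.lyapunov_coe]
      exact (continuous_coe_real_ereal.tendsto _).comp h1
    · simp only [ProxDGD.objective_coe]
      exact (continuous_coe_real_ereal.tendsto _).comp h2
  · simpa using (hconv hc).2
  · simpa using (hpos hl).2
  · exact ProxDGD.frechetSubdiff_subset_subdiff _ _ (hsub k)
  · rintro ⟨Lr, hLr, k₀, -, hk₀⟩
    have hgl := ProxDGD.norm_gradStack_sub_le (n := n) (p := p) hf hLle hLf0.le
    have hP := hT.tendsto_proj_zero hstep hdiv hit hv hFq hR1 hb (A := Lf + Lr) (by positivity) (by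
      -- The Lipschitz hypothesis is applied at index `k + 1`, so `k₀ ≤ k` is enough. The gradient
      -- change is paid by the first increment, the subgradient change by the second.
      filter_upwards [eventually_ge_atTop k₀] with k hk
      have h1 := hgl (x (k + 1)) (x k)
      have h2 := hk₀ (k + 1) (by omega)
      rw [show ProxDGD.gradStack f (x (k + 1)) + ξ (k + 2)
          - (ProxDGD.gradStack f (x k) + ξ (k + 1))
        = (ProxDGD.gradStack f (x (k + 1)) - ProxDGD.gradStack f (x k))
          + (ξ (k + 2) - ξ (k + 1)) by abel]
      refine (norm_add_le _ _).trans ((add_le_add h1 h2).trans ?_)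
      have h3 := mul_nonneg hLr.le (norm_nonneg (x (k + 1) - x k))
      have h4 := mul_nonneg hLf0.le (norm_nonneg (x (k + 2) - x (k + 1)))
      linarith)
    have hlim : Tendsto (fun k => ∑ i, (ProxDGD.gradStack f (x k) i + ξ (k + 1) i)) atTop
        (𝓝 0) := by
      refine squeeze_zero_norm (a := fun k => (n : ℝ) *
        ‖ProxDGD.avgLinear (ProxDGD.gradStack f (x k) + ξ (k + 1))‖) (fun k => ?_) ?_
      · have h1 := ProxDGD.sum_row_eq (ProxDGD.gradStack f (x k) + ξ (k + 1))
        simp only [PiLp.add_apply] at h1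
        rw [h1, norm_smul, Real.norm_of_nonneg (Nat.cast_nonneg n)]
        gcongr
        exact PiLp.norm_apply_le _ _
      · simpa using hP.norm.const_mul (n : ℝ)
    refine ⟨hlim, fun y hy => ?_⟩
    refine ProxDGD.isStationary_of_mapClusterPt hT hstep hit hv hξB ?_ ?_ hsub hlim hy
    · exact (LipschitzWith.of_dist_le_mul (K := ⟨Lf, hLf0.le⟩) fun u v => by
        rw [dist_eq_norm, dist_eq_norm]
        exact hgl u v).continuous
    · exact (LipschitzWith.of_dist_le_mul (K := ⟨MR, hMR⟩) fun u v => by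
        rw [Real.dist_eq, dist_eq_norm]
        exact hRlip u v).continuous
  · obtain ⟨C, -, hC⟩ := hT.exists_increment_le hstep hit hv
    refine ProxDGD.tendsto_of_isolated_mapClusterPt (squeeze_zero_norm hC ?_) hy hiso
    simpa using hstep.tendsto_zero.const_mul C
  -- On a connected graph the feasible stacks are the constant ones, so the problem is to minimize
  -- `∑ i, (f i u + ρ i u)` over a single `u`.
  · obtain ⟨u₀, hu₀⟩ := ProxDGD.exists_sum_forall_le hcoer' hcont
    set y : ProxDGD.Stack n p := WithLp.toLp 2 fun _ => u₀ with hy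
    set S : ProxDGD.Stack n p → ℝ := fun z => ProxDGD.smoothSum f z + ProxDGD.smoothSum ρ z with hS
    have hmin : ∀ z : ProxDGD.Stack n p, (∀ i j, z i = z j) → S y ≤ S z := by
      intro z hz
      have h1 := hu₀ (z 0)
      simp only [hS, ProxDGD.smoothSum, ← Finset.sum_add_distrib]
      refine h1.trans (le_of_eq (Finset.sum_congr rfl fun i _ => ?_))
      rw [hz i 0]
    have hPy : ProxDGD.avgLinear y = y := ProxDGD.avg_eq_of_forall_eq fun _ _ => rfl
    obtain ⟨C, hC, herg⟩ := hT.ergodic_estimate hstep hit hv hMR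
      (le_max_of_le_left hMF : 0 ≤ max MF MR) hξB
      (fun u w => (hFlip u w).trans
        (mul_le_mul_of_nonneg_right (le_max_left _ _) (norm_nonneg _)))
      (fun u w => (hRlip u w).trans
        (mul_le_mul_of_nonneg_right (le_max_right _ _) (norm_nonneg _)))
      (fun k u => ProxDGD.smoothSum_gradient_le hf hfc (x k) u) (hRc hrc) hPy
    set sbar : ℕ → ℝ := fun K => (∑ k ∈ Finset.range (K + 1), α k * S (ProxDGD.avg (x (k + 1))))
      / ∑ k ∈ Finset.range (K + 1), α k with hsbar
    have hApos : ∀ K, 0 < ∑ k ∈ Finset.range (K + 1), α k := fun K =>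
      Finset.sum_pos (fun k _ => hstep.pos k) (by simp)
    have hdiff : ∀ K, (sbar K - S y) * ∑ k ∈ Finset.range (K + 1), α k
        = ∑ k ∈ Finset.range (K + 1), α k * (S (ProxDGD.avg (x (k + 1))) - S y) := by
      intro K
      simp only [hsbar, mul_sub, Finset.sum_sub_distrib]
      rw [sub_mul, div_mul_cancel₀ _ (hApos K).ne', ← Finset.sum_mul, mul_comm (S y)]
    have hnonneg : ∀ K, 0 ≤ sbar K - S y := by
      intro K
      refine nonneg_of_mul_nonneg_left ?_ (hApos K)
      rw [hdiff]
      exact Finset.sum_nonneg fun k _ => mul_nonneg (hstep.pos k).le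
        (sub_nonneg.2 (hmin _ fun _ _ => rfl))
    have hupper : ∀ K, (sbar K - S y) * ∑ k ∈ Finset.range (K + 1), α k ≤
        ‖ProxDGD.avgLinear (x 0) - y‖ ^ 2 / 2 + C * ∑ k ∈ Finset.range (K + 1), α k ^ 2 := by
      intro K
      rw [hdiff]
      -- The squared distances to `y` telescope, leaving the initial one and the sum of squared
      -- steps.
      refine (Finset.sum_le_sum fun k _ => herg k).trans ?_
      rw [Finset.sum_add_distrib, ← Finset.sum_div,
        Finset.sum_range_sub' (fun k => ‖ProxDGD.avgLinear (x k) - y‖ ^ 2), ← Finset.mul_sum]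
      gcongr
      linarith [sq_nonneg ‖ProxDGD.avgLinear (x (K + 1)) - y‖]
    rw [hα] at hupper
    obtain ⟨C', hC', hbound⟩ := ProxDGD.exists_bound_of_stepSize hLf0 (by positivity) hC hupper
    have h₁ := ProxDGD.isBigO_of_lt_half hnonneg hC' hbound hε
    have h₂ := ProxDGD.isBigO_of_eq_half hnonneg hC' hbound
    have h₃ := ProxDGD.isBigO_of_gt_half hnonneg hC' hbound
    have h₄ := ProxDGD.isBigO_of_eq_one hnonneg hC' hbound
    refine ⟨S y, sbar, ⟨⟨y, fun _ _ _ => rfl, ProxDGD.objective_coe f ρ y⟩, ?_⟩,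
      ProxDGD.ergodicObjective_coe f ρ α x, ?_, h₁, h₂, h₃, h₄⟩
    · rintro _ ⟨z, hz, rfl⟩
      rw [ProxDGD.objective_coe, EReal.coe_le_coe_iff]
      exact hmin z ((ProxDGD.mem_consensusSet_iff hG).1 hz)
    · simpa using (ProxDGD.tendsto_zero_of_rates hε hε1 h₁ h₂ h₃ h₄).add_const (S y)
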